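/- Fix $L>0$, $\beta\ge 1$ and $\kappa>0$. There are constants $c_1,c_2>0$ depending only on $L,\beta,\kappa$ such that the following holds. Let $1\le r\le n$ be integers, and let $s_0\le s_1$ be non-negative integers with $2^{s_0}$ equal to $\kappa n/r$ up to rounding to a power of two: $\frac12\,\kappa n/r\le 2^{s_0}\le 2\,\kappa n/r$. Let $\xi=(\xi_1,\dots,\xi_n)$ have independent coordinates that are mean-zero, of variance $1$ and $L$-subgaussian, i.e. $(\mathbb E|\xi_i|^p)^{1/p}\le L\sqrt p\,(\mathbb E|\xi_i|^2)^{1/2}$ for all $p\ge 1$. Let $U,W,O$ be $n\times n$ matrices, either all real orthogonal or all complex unitary, whose entries have absolute value at most $\beta/\sqrt n$, and for $x\in\mathbb R^n$ put $\Gamma_x=\sqrt n\,U D_{Wx} O$, where $D_{Wx}$ is the diagonal matrix with diagonal $Wx$. Let $V_r=\{x\in\mathbb R^n:\|x\|_2=1,\ |\{i:x_i\ne 0\}|\le r\}$, let $V_{r,s_1}\subset V_r$ be a set with at most $2^{2^{s_1}}$ elements, and let $\mathcal A=\{\Gamma_v: v\in V_{r,s_1}\}$. Let $(\mathcal A_s)_{s\ge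 s_0}$ be an admissible sequence of $\mathcal A$, that is, $\mathcal A_s\subset\mathcal A$ and $|\mathcal A_s|\le 2^{2^s}$ for every $s\ge s_0$, with $\mathcal A_{s_1}=\mathcal A$. For $A\in\mathcal A$ let $\pi_sA$ be a point of $\mathcal A_s$ nearest to $A$ in the operator norm $\|\cdot\|_{2\to2}$, and put $$\gamma_{s_0,s_1}(\mathcal A)=\sup_{A\in\mathcal A}\ \sum_{s=s_0}^{s_1-1}2^{s/2}\,\|\pi_{s+1}A-\pi_sA\|_{2\to2}.$$ Then, with probability at least $1-2^{-c_1n/r}$, $$\sup_{A\in\mathcal A}\Bigl|\,\|A\xi\|_2^2-\|(\pi_{s_0}A)\xi\|_2^2\,\Bigr|\ \le\ c_2\,\gamma_{s_0,s_1}(\mathcal A)\bigl(\gamma_{s_0,s_1}(\mathcal A)+\sqrt n\bigr).$$ -/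

import Mathlib

open MeasureTheory ProbabilityTheory

noncomputable section

namespace CirculantChaining

/-- A real random variable is mean-zero, of variance one, and `L`-subgaussian:
`(E |X|^p)^(1/p) ≤ L √p (E |X|^2)^(1/2)` for every real `p ≥ 1`. The moments are taken in `[0, ∞]`. -/
structure IsStandardSubgaussian {Ω : Type*} [MeasurableSpace Ω] (L : ℝ) (X : Ω → ℝ)
    (μ : Measure Ω) : Prop where
  measurable : Measurable X
  mean_zero : ∫ ω, X ω ∂μ = 0
  variance_one : variance X μ = 1
  moment_le : ∀ p : ℝ, 1 ≤ p →
    eLpNorm X (ENNReal.ofReal p) μ ≤ ENNReal.ofReal (L * √p) * eLpNorm X 2 μ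

/-- An orthogonal (for `𝕜 = ℝ`) or unitary (for `𝕜 = ℂ`) matrix all of whose entries are at most
`β / √n` in absolute value. -/
def IsHadamardType {𝕜 : Type*} [RCLike 𝕜] {n : ℕ} (β : ℝ) (M : Matrix (Fin n) (Fin n) 𝕜) : Prop :=
  M ∈ Matrix.unitaryGroup (Fin n) 𝕜 ∧ ∀ i j, ‖M i j‖ ≤ β / √(n : ℝ)

/-- The matrix `Γ_x = √n U D_{Wx} O`, where `D_{Wx}` is the diagonal matrix with diagonal `Wx`. -/
def Gam {𝕜 : Type*} [RCLike 𝕜] {n : ℕ} (U W O : Matrix (Fin n) (Fin n) 𝕜)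
    (x : EuclideanSpace ℝ (Fin n)) : Matrix (Fin n) (Fin n) 𝕜 :=
  ((√(n : ℝ) : ℝ) : 𝕜) • (U * Matrix.diagonal (W.mulVec fun j => ((x j : ℝ) : 𝕜)) * O)

/-- The set `V_r` of `r`-sparse vectors in the Euclidean unit sphere of `ℝⁿ`. -/
def sparseSphere (n r : ℕ) : Set (EuclideanSpace ℝ (Fin n)) :=
  {x | {i | x i ≠ 0}.ncard ≤ r ∧ ‖x‖ = 1}

/-- The operator norm `‖A‖_{2 → 2}` with respect to the Euclidean norms. -/
def opNorm {𝕜 : Type*} [RCLike 𝕜] {n : ℕ} (A : Matrix (Fin n) (Fin n) 𝕜) : ℝ :=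
  ‖Matrix.toEuclideanCLM (n := Fin n) (𝕜 := 𝕜) A‖

/-- The Euclidean norm `‖A y‖₂` for a real vector `y`. -/
def actNorm {𝕜 : Type*} [RCLike 𝕜] {n : ℕ} (A : Matrix (Fin n) (Fin n) 𝕜) (y : Fin n → ℝ) : ℝ :=
  ‖(WithLp.toLp 2 (A.mulVec fun j => ((y j : ℝ) : 𝕜)) : EuclideanSpace 𝕜 (Fin n))‖

/-- `(𝒜_s)_{s ≥ s₀}` is an admissible sequence of `𝒜`: subsets of `𝒜` with at most `2^(2^s)`
elements. -/
def IsAdmissible {M : Type*} (𝒜 : Set M) (s₀ : ℕ) (𝒜s : ℕ → Set M) : Prop :=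
  ∀ s, s₀ ≤ s → 𝒜s s ⊆ 𝒜 ∧ (𝒜s s).Finite ∧ (𝒜s s).ncard ≤ 2 ^ (2 ^ s)

/-- For every `s ≥ s₀` and `A ∈ 𝒜`, `proj s A` is a point of `𝒜_s` nearest to `A` in operator
norm. -/
def IsNearestPoint {𝕜 : Type*} [RCLike 𝕜] {n : ℕ} (𝒜 : Set (Matrix (Fin n) (Fin n) 𝕜)) (s₀ : ℕ)
    (𝒜s : ℕ → Set (Matrix (Fin n) (Fin n) 𝕜))
    (proj : ℕ → Matrix (Fin n) (Fin n) 𝕜 → Matrix (Fin n) (Fin n) 𝕜) : Prop :=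
  ∀ s, s₀ ≤ s → ∀ A ∈ 𝒜, proj s A ∈ 𝒜s s ∧ ∀ B ∈ 𝒜s s, opNorm (A - proj s A) ≤ opNorm (A - B)

/-- The truncated functional
`γ_{s₀,s₁}(𝒜) = sup_{A ∈ 𝒜} ∑_{s = s₀}^{s₁ - 1} 2^(s/2) ‖π_{s+1} A - π_s A‖_{2 → 2}`. -/
def gammaTrunc {𝕜 : Type*} [RCLike 𝕜] {n : ℕ} (𝒜 : Set (Matrix (Fin n) (Fin n) 𝕜)) (s₀ s₁ : ℕ)
    (proj : ℕ → Matrix (Fin n) (Fin n) 𝕜 → Matrix (Fin n) (Fin n) 𝕜) : ℝ :=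
  ⨆ A : 𝒜, ∑ s ∈ Finset.Ico s₀ s₁,
    (2 : ℝ) ^ ((s : ℝ) / 2) * opNorm (proj (s + 1) A.1 - proj s A.1)

end CirculantChaining

end

/-!
The theorem is proved through moments of the fixed order `p = 2 ^ s₀`, which is comparable to
`n / r`; Markov's inequality then gives a failure probability at most `2 ^ (-p)`.

Write `x_I` for the restriction of a vector `x` to a set `I` of coordinates. Averaging over random
signs splits `‖A x‖²` into its diagonal part `∑ ‖A eᵢ‖² xᵢ²` and four times the average over `I` of
the decoupled forms `⟪A x_I, A x_{Iᶜ}⟫` (`norm_sum_sq_eq_sum_add_average`). From one level of the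
admissible sequence to the next, a decoupled form changes by
`⟪B x, B y⟫ - ⟪C x, C y⟫ = ⟪(B - C) x, B y⟫ + ⟪C x, (B - C) y⟫`, and conditionally on one of the two
blocks each summand is a subgaussian linear form in the other, with parameter at most `‖B - C‖`
times `sup_A ‖A y‖`. A union bound over all levels (`lintegral_sup_pow_le`) therefore bounds the
`p`-th moment of the supremum of the off-diagonal increments by a multiple of `γ` times that of
`sup_A ‖A ξ_J‖` (`eLpNorm_avgChaos_le`).

The last quantity is bounded by feeding the same estimate into itself: applied to chains that start
at `0` it gives `X² ≤ C n + C (γ + √n) X` for the largest moment `X` of order `2 p` of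
`sup_A ‖A ξ_J‖`, over all blocks `J`, whence `X ≤ C (γ + √n)` (`eLpNorm_supNorm_le`). Here the
choice of `s₀` enters: the first step of a chain has weight `2 ^ (s₀ / 2) ‖Γ_v‖`, and
`‖Γ_v‖ ≤ β √r` for sparse `v`.

For the diagonal part, the columns of `Γ_v` have norm at most `β` and `∑ ‖Γ_v eᵢ‖² = n` for all `v`,
so that an increment is `∑ aᵢ (ξᵢ² - 1)` with `|aᵢ| ≤ 2 β ‖B - C‖`. On levels with `2 ^ s ≤ n`
Bernstein's inequality is in its subgaussian range; on later levels the trivial bound by `‖ξ‖²` is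
already good enough (`abs_sum_diagCoeff_le`, `eLpNorm_diagSup_le`).
-/

noncomputable section

namespace CirculantChaining

open scoped ENNReal NNReal

/-! ### Exponential moments of a subgaussian variable -/

section Scalar

variable {Ω : Type*} [MeasurableSpace Ω] {μ : Measure Ω}

lemma IsStandardSubgaussian.lintegral_sq {L : ℝ} {X : Ω → ℝ}
    (h : IsStandardSubgaussian L X μ) : ∫⁻ ω, ‖X ω‖ₑ ^ 2 ∂μ = 1 := by
  have hv := h.variance_one
  rw [variance, evariance, h.mean_zero] at hv
  simp only [sub_zero] at hv
  rw [← ENNReal.ofReal_toReal (a := ∫⁻ ω, ‖X ω‖ₑ ^ 2 ∂μ), hv, ENNReal.ofReal_one]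
  intro htop
  rw [htop] at hv
  simp at hv

lemma IsStandardSubgaussian.eLpNorm_two {L : ℝ} {X : Ω → ℝ}
    (h : IsStandardSubgaussian L X μ) : eLpNorm X 2 μ = 1 := by
  have h1 := eLpNorm_nnreal_pow_eq_lintegral (f := X) (μ := μ) (p := 2) (by norm_num)
  have h2 := h.lintegral_sq
  simp only [NNReal.coe_ofNat, ENNReal.coe_ofNat, ENNReal.rpow_ofNat] at h1
  rw [h2] at h1
  refine le_antisymm ((ENNReal.pow_le_pow_left_iff two_ne_zero).1 ?_)
    ((ENNReal.pow_le_pow_left_iff two_ne_zero).1 ?_) <;> rw [h1, one_pow]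

lemma IsStandardSubgaussian.lintegral_pow_le {L : ℝ} {X : Ω → ℝ}
    (h : IsStandardSubgaussian L X μ) {k : ℕ} (hk : 1 ≤ k) :
    ∫⁻ ω, ‖X ω‖ₑ ^ k ∂μ ≤ ENNReal.ofReal (L * √k) ^ k := by
  have h1 := h.moment_le k (by exact_mod_cast hk)
  rw [h.eLpNorm_two, mul_one, ENNReal.ofReal_natCast] at h1
  have h2 := eLpNorm_nnreal_pow_eq_lintegral (f := X) (μ := μ) (p := k)
    (by exact_mod_cast (by lia : k ≠ 0))
  simp only [NNReal.coe_natCast, ENNReal.coe_natCast, ENNReal.rpow_natCast] at h2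
  rw [← h2]
  gcongr

lemma IsStandardSubgaussian.memLp_two {L : ℝ} {X : Ω → ℝ}
    (h : IsStandardSubgaussian L X μ) : MemLp X 2 μ :=
  ⟨h.measurable.aestronglyMeasurable, by rw [h.eLpNorm_two]; simp⟩

lemma IsStandardSubgaussian.integral_sq {L : ℝ} {X : Ω → ℝ}
    (h : IsStandardSubgaussian L X μ) : ∫ ω, X ω ^ 2 ∂μ = 1 := by
  have hv := h.variance_one
  rwa [variance_of_integral_eq_zero h.measurable.aemeasurable h.mean_zero] at hv

lemma eLpNorm_le_of_lintegral_pow_le {Y : Ω → ℝ} {q : ℕ} (hq : q ≠ 0) {K : ℝ≥0∞}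
    (h : ∫⁻ ω, ‖Y ω‖ₑ ^ q ∂μ ≤ K ^ q) : eLpNorm Y q μ ≤ K := by
  have h2 := eLpNorm_nnreal_pow_eq_lintegral (f := Y) (μ := μ) (p := q) (by exact_mod_cast hq)
  simp only [NNReal.coe_natCast, ENNReal.coe_natCast, ENNReal.rpow_natCast] at h2
  rw [← h2] at h
  exact (ENNReal.pow_le_pow_left_iff hq).1 h

lemma eLpNorm_pow_eq_lintegral {Y : Ω → ℝ} {q : ℕ} (hq : q ≠ 0) :
    eLpNorm Y q μ ^ q = ∫⁻ ω, ‖Y ω‖ₑ ^ q ∂μ := by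
  have h2 := eLpNorm_nnreal_pow_eq_lintegral (f := Y) (μ := μ) (p := q) (by exact_mod_cast hq)
  simpa only [NNReal.coe_natCast, ENNReal.coe_natCast, ENNReal.rpow_natCast] using h2

lemma eLpNorm_coe_pow_eq {f : Ω → ℝ≥0} {q : ℕ} (hq : q ≠ 0) :
    eLpNorm (fun ω => (f ω : ℝ)) q μ ^ q = ∫⁻ ω, (f ω : ℝ≥0∞) ^ q ∂μ := by
  rw [eLpNorm_pow_eq_lintegral hq]
  simp

/-- A two-sided bound on the moment generating function at `l` bounds the `q`-th moment, since
`|y| ^ q ≤ q! l⁻ᵠ e ^ {l |y|}`. -/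
lemma lintegral_pow_le_of_mgf_le {Y : Ω → ℝ} {l b : ℝ} (hl : 0 < l)
    (h1 : Integrable (fun ω => Real.exp (l * Y ω)) μ)
    (h2 : Integrable (fun ω => Real.exp (-l * Y ω)) μ)
    (hb1 : mgf Y μ l ≤ b) (hb2 : mgf Y μ (-l) ≤ b) (q : ℕ) :
    ∫⁻ ω, ‖Y ω‖ₑ ^ q ∂μ ≤ ENNReal.ofReal (2 * b * (q / l) ^ q) := by
  have key : ∀ ω, ‖Y ω‖ₑ ^ q ≤ ENNReal.ofReal
      ((q / l) ^ q * (Real.exp (l * Y ω) + Real.exp (-l * Y ω))) := by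
    intro ω
    rw [Real.enorm_eq_ofReal_abs, ← ENNReal.ofReal_pow (abs_nonneg _)]
    apply ENNReal.ofReal_le_ofReal
    have h3 : Real.exp (l * |Y ω|) ≤ Real.exp (l * Y ω) + Real.exp (-l * Y ω) := by
      rcases abs_choice (Y ω) with h | h <;> rw [h]
      · linarith [Real.exp_pos (-l * Y ω)]
      · rw [mul_neg, ← neg_mul]; linarith [Real.exp_pos (l * Y ω)]
    have h4 := Real.pow_div_factorial_le_exp (l * |Y ω|) (by positivity) q
    have h5 : (q.factorial : ℝ) ≤ (q : ℝ) ^ q := by exact_mod_cast Nat.factorial_le_pow q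
    calc |Y ω| ^ q = (q.factorial / l ^ q) * ((l * |Y ω|) ^ q / q.factorial) := by
          rw [mul_pow]; field_simp
      _ ≤ (q ^ q / l ^ q) * (Real.exp (l * Y ω) + Real.exp (-l * Y ω)) := by
          gcongr
          exact h4.trans h3
      _ = _ := by rw [div_pow]
  calc _ ≤ ∫⁻ ω, ENNReal.ofReal ((q / l) ^ q * (Real.exp (l * Y ω) + Real.exp (-l * Y ω))) ∂μ :=
        lintegral_mono key
    _ = ENNReal.ofReal (∫ ω, (q / l) ^ q * (Real.exp (l * Y ω) + Real.exp (-l * Y ω)) ∂μ) := by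
        exact (ofReal_integral_eq_lintegral_ofReal ((h1.add h2).const_mul _)
          (ae_of_all _ fun ω => by simp only [Pi.zero_apply, Pi.add_apply]; positivity)).symm
    _ ≤ _ := by
        apply ENNReal.ofReal_le_ofReal
        rw [integral_const_mul, integral_add h1 h2]
        rw [mgf] at hb1 hb2
        have : (0 : ℝ) ≤ (q / l) ^ q := by positivity
        nlinarith

/-- The exponential rate `2 e L²` governing the square of an `L`-subgaussian variable. -/
def sqRate (L : ℝ) : ℝ := 2 * Real.exp 1 * L ^ 2

lemma sqRate_pos {L : ℝ} (hL : 0 < L) : 0 < sqRate L := by unfold sqRate; positivity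

variable [IsProbabilityMeasure μ]

/-- The power series of `exp (u X²)` is dominated by a geometric series, as `k ^ k ≤ e ^ k k!`. -/
lemma IsStandardSubgaussian.lintegral_exp_sq_le {L : ℝ} (hL : 0 < L) {X : Ω → ℝ}
    (h : IsStandardSubgaussian L X μ) {u : ℝ} (hu : 0 ≤ u) (hu' : 2 * sqRate L * u ≤ 1) :
    ∫⁻ ω, ENNReal.ofReal (Real.exp (u * X ω ^ 2)) ∂μ ≤
      ENNReal.ofReal (1 + 2 * sqRate L * u) := by
  have hmeas := h.measurable
  set x := sqRate L * u with hx
  have hx0 : 0 ≤ x := mul_nonneg (sqRate_pos hL).le hu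
  have hx2 : x ≤ 1 / 2 := by rw [hx]; linarith
  have hexp : ∀ ω, ENNReal.ofReal (Real.exp (u * X ω ^ 2)) =
      ∑' k : ℕ, ENNReal.ofReal ((u * X ω ^ 2) ^ k / k.factorial) := by
    intro ω
    rw [Real.exp_eq_exp_ℝ, NormedSpace.exp_eq_tsum_div]
    exact ENNReal.ofReal_tsum_of_nonneg (fun k => by positivity)
      (Real.summable_pow_div_factorial _)
  have hterm : ∀ k : ℕ, ∫⁻ ω, ENNReal.ofReal ((u * X ω ^ 2) ^ k / k.factorial) ∂μ ≤
      ENNReal.ofReal (x ^ k) := by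
    intro k
    rcases Nat.eq_zero_or_pos k with rfl | hk
    · simp
    have h1 := h.lintegral_pow_le (k := 2 * k) (by lia)
    have h2 : ∀ ω, ENNReal.ofReal ((u * X ω ^ 2) ^ k / k.factorial) =
        ENNReal.ofReal (u ^ k / k.factorial) * ‖X ω‖ₑ ^ (2 * k) := by
      intro ω
      rw [Real.enorm_eq_ofReal_abs, ← ENNReal.ofReal_pow (abs_nonneg _),
        ← ENNReal.ofReal_mul (by positivity), pow_mul, sq_abs, mul_pow]
      congr 1
      ring
    simp_rw [h2]
    rw [lintegral_const_mul _ (by fun_prop)]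
    calc _ ≤ ENNReal.ofReal (u ^ k / k.factorial) *
          ENNReal.ofReal (L * √(2 * k : ℕ)) ^ (2 * k) := by gcongr
      _ = ENNReal.ofReal (u ^ k / k.factorial * (L * √(2 * k : ℕ)) ^ (2 * k)) := by
          rw [← ENNReal.ofReal_pow (by positivity), ← ENNReal.ofReal_mul (by positivity)]
      _ ≤ _ := by
          apply ENNReal.ofReal_le_ofReal
          have h3 : (k : ℝ) ^ k / k.factorial ≤ Real.exp 1 ^ k := by
            rw [← Real.exp_nat_mul, mul_one]
            exact Real.pow_div_factorial_le_exp _ (Nat.cast_nonneg k) k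
          rw [pow_mul, mul_pow, Real.sq_sqrt (by positivity), hx, sqRate]
          push_cast
          calc u ^ k / k.factorial * (L ^ 2 * (2 * k)) ^ k
              = (2 * L ^ 2 * u) ^ k * ((k : ℝ) ^ k / k.factorial) := by
                rw [mul_pow, mul_pow, mul_pow, mul_pow]; ring
            _ ≤ (2 * L ^ 2 * u) ^ k * Real.exp 1 ^ k := by gcongr
            _ = _ := by rw [← mul_pow]; ring
  simp_rw [hexp]
  rw [lintegral_tsum (fun k => by fun_prop)]
  have hgeo : Summable fun k : ℕ => x ^ k := summable_geometric_of_lt_one hx0 (by linarith)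
  calc _ ≤ ∑' k : ℕ, ENNReal.ofReal (x ^ k) := ENNReal.tsum_le_tsum hterm
    _ = ENNReal.ofReal (1 - x)⁻¹ := by
        rw [← ENNReal.ofReal_tsum_of_nonneg (fun k => by positivity) hgeo,
          tsum_geometric_of_lt_one hx0 (by linarith)]
    _ ≤ _ := by
        apply ENNReal.ofReal_le_ofReal
        rw [inv_le_iff_one_le_mul₀ (by linarith)]
        nlinarith

lemma IsStandardSubgaussian.integrable_exp_sq {L : ℝ} (hL : 0 < L) {X : Ω → ℝ}
    (h : IsStandardSubgaussian L X μ) {u : ℝ} (hu' : 2 * sqRate L * u ≤ 1) :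
    Integrable (fun ω => Real.exp (u * X ω ^ 2)) μ := by
  have hmeas := h.measurable
  rcases le_total 0 u with hu | hu
  · refine ⟨by fun_prop, ?_⟩
    rw [hasFiniteIntegral_iff_ofReal (ae_of_all _ fun ω => (Real.exp_pos _).le)]
    exact (h.lintegral_exp_sq_le hL hu hu').trans_lt ENNReal.ofReal_lt_top
  · refine Integrable.of_bound (C := 1) (by fun_prop) (ae_of_all _ fun ω => ?_)
    rw [Real.norm_eq_abs, abs_of_pos (Real.exp_pos _), Real.exp_le_one_iff]
    exact mul_nonpos_of_nonpos_of_nonneg hu (sq_nonneg _)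

lemma IsStandardSubgaussian.integral_exp_sq_le {L : ℝ} (hL : 0 < L) {X : Ω → ℝ}
    (h : IsStandardSubgaussian L X μ) {u : ℝ} (hu : 0 ≤ u) (hu' : 2 * sqRate L * u ≤ 1) :
    ∫ ω, Real.exp (u * X ω ^ 2) ∂μ ≤ 1 + 2 * sqRate L * u := by
  have hmeas := h.measurable
  rw [integral_eq_lintegral_of_nonneg_ae (ae_of_all _ fun ω => (Real.exp_pos _).le) (by fun_prop)]
  have := sqRate_pos hL
  exact ENNReal.toReal_le_of_le_ofReal (by positivity) (h.lintegral_exp_sq_le hL hu hu')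

lemma exp_le_add_exp_sq (x : ℝ) : Real.exp x ≤ x + Real.exp (x ^ 2) := by
  by_cases hx : |x| ≤ 1
  · have h1 := abs_le.1 (Real.abs_exp_sub_one_sub_id_le hx)
    have h2 := Real.add_one_le_exp (x ^ 2)
    linarith [h1.2]
  · rw [not_le, lt_abs] at hx
    rcases hx with hx | hx
    · have : Real.exp x ≤ Real.exp (x ^ 2) := Real.exp_le_exp.2 (by nlinarith)
      linarith
    · have h1 : Real.exp x ≤ 1 := Real.exp_le_one_iff.2 (by linarith)
      have h2 := Real.add_one_le_exp (x ^ 2)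
      nlinarith

lemma IsStandardSubgaussian.integrable_exp_mul {L : ℝ} (hL : 0 < L) {X : Ω → ℝ}
    (h : IsStandardSubgaussian L X μ) (t : ℝ) : Integrable (fun ω => Real.exp (t * X ω)) μ := by
  have hmeas := h.measurable
  have ha := sqRate_pos hL
  set u := 1 / (2 * sqRate L) with hu
  have hu0 : 0 < u := by positivity
  refine ((h.integrable_exp_sq hL (u := u) (by rw [hu]; field_simp; rfl)).const_mul
    (Real.exp (t ^ 2 / (4 * u)))).mono' (by fun_prop) (ae_of_all _ fun ω => ?_)
  rw [Real.norm_eq_abs, abs_of_pos (Real.exp_pos _), ← Real.exp_add, Real.exp_le_exp]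
  have : t ^ 2 / (4 * u) + u * X ω ^ 2 - t * X ω = (t - 2 * u * X ω) ^ 2 / (4 * u) := by
    field_simp; ring
  have h2 : 0 ≤ (t - 2 * u * X ω) ^ 2 / (4 * u) := by positivity
  linarith

/-- For small `t` this follows from `e ^ x ≤ x + e ^ {x²}` and the mean-zero property; for large `t`
from `t X ≤ u X² + t² / (4 u)`, the factor `2` being absorbed into the exponential. -/
lemma IsStandardSubgaussian.mgf_le {L : ℝ} (hL : 0 < L) {X : Ω → ℝ}
    (h : IsStandardSubgaussian L X μ) (t : ℝ) : mgf X μ t ≤ Real.exp (3 * sqRate L * t ^ 2) := by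
  have hmeas := h.measurable
  have ha := sqRate_pos hL
  rw [mgf]
  by_cases ht : 2 * sqRate L * t ^ 2 ≤ 1
  · calc ∫ ω, Real.exp (t * X ω) ∂μ ≤ ∫ ω, (t * X ω + Real.exp (t ^ 2 * X ω ^ 2)) ∂μ := by
          refine integral_mono (h.integrable_exp_mul hL t)
            (((h.memLp_two.integrable one_le_two).const_mul t).add (h.integrable_exp_sq hL ht))
            fun ω => ?_
          simpa [mul_pow] using exp_le_add_exp_sq (t * X ω)
      _ = ∫ ω, Real.exp (t ^ 2 * X ω ^ 2) ∂μ := by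
          rw [integral_add ((h.memLp_two.integrable one_le_two).const_mul t)
            (h.integrable_exp_sq hL ht), integral_const_mul, h.mean_zero]
          simp
      _ ≤ 1 + 2 * sqRate L * t ^ 2 := h.integral_exp_sq_le hL (sq_nonneg t) ht
      _ ≤ Real.exp (2 * sqRate L * t ^ 2) := by
          linarith [Real.add_one_le_exp (2 * sqRate L * t ^ 2)]
      _ ≤ _ := Real.exp_le_exp.2 (by nlinarith [mul_nonneg ha.le (sq_nonneg t)])
  · rw [not_le] at ht
    set u := 1 / (2 * sqRate L) with hu
    have hu0 : 0 < u := by positivity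
    have hu1 : 2 * sqRate L * u = 1 := by rw [hu]; field_simp
    calc ∫ ω, Real.exp (t * X ω) ∂μ
        ≤ ∫ ω, Real.exp (t ^ 2 / (4 * u)) * Real.exp (u * X ω ^ 2) ∂μ := by
          refine integral_mono (h.integrable_exp_mul hL t)
            ((h.integrable_exp_sq hL hu1.le).const_mul _) fun ω => ?_
          simp only
          rw [← Real.exp_add, Real.exp_le_exp]
          have : t ^ 2 / (4 * u) + u * X ω ^ 2 - t * X ω = (t - 2 * u * X ω) ^ 2 / (4 * u) := by
            field_simp; ring
          have h2 : 0 ≤ (t - 2 * u * X ω) ^ 2 / (4 * u) := by positivity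
          linarith
      _ ≤ Real.exp (t ^ 2 / (4 * u)) * (1 + 2 * sqRate L * u) := by
          rw [integral_const_mul]
          gcongr
          exact h.integral_exp_sq_le hL hu0.le hu1.le
      _ ≤ Real.exp (t ^ 2 / (4 * u)) * Real.exp (2 * sqRate L * t ^ 2) := by
          gcongr
          rw [hu1]
          linarith [Real.add_one_le_exp (2 * sqRate L * t ^ 2)]
      _ ≤ _ := by
          rw [← Real.exp_add, Real.exp_le_exp]
          have : t ^ 2 / (4 * u) = sqRate L * t ^ 2 / 2 := by rw [hu]; field_simp; ring
          rw [this]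
          nlinarith [mul_nonneg ha.le (sq_nonneg t)]

end Scalar

/-! ### Moments of linear forms and of sums of squares -/

section Vector

variable {Ω : Type*} [MeasurableSpace Ω] {μ : Measure Ω} [IsProbabilityMeasure μ]
  {ι : Type*} [Fintype ι] {ξ : ι → Ω → ℝ} {L : ℝ}

/-- The constant in the moment bound for linear forms. -/
def linConst (L : ℝ) : ℝ := 2 * Real.exp (3 * sqRate L)

lemma linConst_pos (L : ℝ) : 0 < linConst L := by unfold linConst; positivity

lemma lintegral_linear_pow_le (hL : 0 < L) (hξ : ∀ i, IsStandardSubgaussian L (ξ i) μ)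
    (hind : iIndepFun ξ μ) (a : ι → ℝ) {q : ℕ} (hq : 1 ≤ q) :
    ∫⁻ ω, ‖∑ i, a i * ξ i ω‖ₑ ^ q ∂μ ≤
      ENNReal.ofReal (linConst L * √q * √(∑ i, a i ^ 2)) ^ q := by
  have hmeas := fun i => (hξ i).measurable
  set v := ∑ i, a i ^ 2 with hv
  have hv0 : 0 ≤ v := Finset.sum_nonneg fun i _ => sq_nonneg _
  rcases hv0.eq_or_lt with h0 | hpos
  · have ha : ∀ i, a i = 0 := fun i => by
      have := (Finset.sum_eq_zero_iff_of_nonneg (fun i _ => sq_nonneg (a i))).1 h0.symm i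
        (Finset.mem_univ i)
      simpa using this
    simp [ha, (by lia : q ≠ 0)]
  have hY : (fun ω => ∑ i, a i * ξ i ω) = ∑ i, fun ω => a i * ξ i ω := by
    ext ω; simp
  have hind' : iIndepFun (fun i ω => a i * ξ i ω) μ :=
    hind.comp (fun i x => a i * x) fun i => by fun_prop
  have hint : ∀ t, Integrable (fun ω => Real.exp (t * ∑ i, a i * ξ i ω)) μ := by
    intro t
    have := hind'.integrable_exp_mul_sum (t := t) (fun i => (hmeas i).const_mul _)
      (s := Finset.univ) fun i _ => by
        simpa only [mul_assoc] using (hξ i).integrable_exp_mul hL (t * a i)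
    simpa only [Finset.sum_apply] using this
  have hmgf : ∀ t, mgf (fun ω => ∑ i, a i * ξ i ω) μ t ≤
      Real.exp (3 * sqRate L * t ^ 2 * v) := by
    intro t
    rw [hY, hind'.mgf_sum (fun i => (hmeas i).const_mul _), hv, Finset.mul_sum, Real.exp_sum]
    refine Finset.prod_le_prod (fun i _ => mgf_nonneg) fun i _ => ?_
    rw [mgf_const_mul]
    refine ((hξ i).mgf_le hL _).trans_eq ?_
    congr 1; ring
  have hq0 : (0 : ℝ) < q := by exact_mod_cast hq
  set l := √q / √v with hl
  have hl0 : 0 < l := by positivity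
  have hl2 : l ^ 2 * v = q := by
    rw [hl, div_pow, Real.sq_sqrt hq0.le, Real.sq_sqrt hv0]; field_simp
  refine (lintegral_pow_le_of_mgf_le hl0 (hint l) (hint (-l)) (hmgf l)
    ((hmgf (-l)).trans_eq (by rw [neg_sq])) q).trans ?_
  rw [← ENNReal.ofReal_pow (by have := linConst_pos L; positivity)]
  apply ENNReal.ofReal_le_ofReal
  have h1 : (q : ℝ) / l = √q * √v := by
    rw [hl]; field_simp; rw [Real.sq_sqrt hq0.le]
  have h2 : (2 : ℝ) ≤ 2 ^ q := le_self_pow₀ one_le_two (by lia)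
  calc 2 * Real.exp (3 * sqRate L * l ^ 2 * v) * (q / l) ^ q
      ≤ 2 ^ q * Real.exp (3 * sqRate L) ^ q * (√q * √v) ^ q := by
        rw [h1, mul_assoc (3 * sqRate L), hl2, ← Real.exp_nat_mul, mul_comm (q : ℝ) (3 * sqRate L)]
        gcongr
    _ = _ := by rw [← mul_pow, ← mul_pow, linConst]; congr 1; ring

/-- The constant in the one-variable bound `E exp (u (X² - 1)) ≤ exp (B u²)`. -/
def bernConst (L : ℝ) : ℝ := 64 * sqRate L ^ 2 * Real.exp (1 / (2 * sqRate L))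

lemma bernConst_pos (hL : 0 < L) : 0 < bernConst L := by
  have := sqRate_pos hL
  unfold bernConst; positivity

lemma exp_le_one_add_add_sq_mul_exp (x : ℝ) :
    Real.exp x ≤ 1 + x + x ^ 2 * Real.exp |x| := by
  have h := Complex.norm_exp_sub_sum_le_norm_mul_exp (x : ℂ) 2
  have h2 : Complex.exp (x : ℂ) - ∑ m ∈ Finset.range 2, (x : ℂ) ^ m / m.factorial =
      ((Real.exp x - (1 + x) : ℝ) : ℂ) := by
    simp [Finset.sum_range_succ]
  rw [h2, Complex.norm_real, Complex.norm_real, Real.norm_eq_abs, Real.norm_eq_abs, sq_abs] at h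
  linarith [le_abs_self (Real.exp x - (1 + x))]

lemma IsStandardSubgaussian.integrable_exp_sq_sub_one (hL : 0 < L) {X : Ω → ℝ}
    (h : IsStandardSubgaussian L X μ) {u : ℝ} (hu : 2 * sqRate L * u ≤ 1) :
    Integrable (fun ω => Real.exp (u * (X ω ^ 2 - 1))) μ := by
  have := (h.integrable_exp_sq hL hu).const_mul (Real.exp (-u))
  refine this.congr (ae_of_all _ fun ω => ?_)
  simp only
  rw [← Real.exp_add]; congr 1; ring

lemma IsStandardSubgaussian.mgf_sq_sub_one_le (hL : 0 < L) {X : Ω → ℝ}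
    (h : IsStandardSubgaussian L X μ) {u : ℝ} (hu : 4 * sqRate L * |u| ≤ 1) :
    mgf (fun ω => X ω ^ 2 - 1) μ u ≤ Real.exp (bernConst L * u ^ 2) := by
  have ha := sqRate_pos hL
  set a := sqRate L with ha'
  have hmeas := h.measurable
  have hint2 : Integrable (fun ω => Real.exp (1 / (2 * a) * X ω ^ 2)) μ :=
    h.integrable_exp_sq hL (by rw [← ha']; field_simp; rfl)
  have hu2 : 2 * sqRate L * u ≤ 1 := by
    nlinarith [le_abs_self u, abs_nonneg u, mul_nonneg ha.le (abs_nonneg u)]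
  have hsq : Integrable (fun ω => X ω ^ 2) μ := h.memLp_two.integrable_sq
  -- With `δ = 1 / (4 a)`: `g² ≤ 2 δ⁻² e^{δ |g|}` and `|u| ≤ δ`, so that
  -- `g² e^{|u g|} ≤ 32 a² e^{2 δ |g|}`.
  have hpt : ∀ ω, Real.exp (u * (X ω ^ 2 - 1)) ≤ (1 + u * (X ω ^ 2 - 1)) +
      u ^ 2 * (32 * a ^ 2 * Real.exp (1 / (2 * a))) * Real.exp (1 / (2 * a) * X ω ^ 2) := by
    intro ω
    set g := X ω ^ 2 - 1 with hg
    have hgX : |g| ≤ X ω ^ 2 + 1 := by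
      rw [abs_le]; constructor <;> nlinarith [sq_nonneg (X ω)]
    refine (exp_le_one_add_add_sq_mul_exp (u * g)).trans ?_
    gcongr 1 + _ + ?_
    have h1 : g ^ 2 ≤ 32 * a ^ 2 * Real.exp (|g| / (4 * a)) := by
      have h2 := Real.pow_div_factorial_le_exp (|g| / (4 * a)) (by positivity) 2
      rw [div_pow, sq_abs] at h2
      have h3 : g ^ 2 = 32 * a ^ 2 * (g ^ 2 / (4 * a) ^ 2 / (Nat.factorial 2 : ℕ)) := by
        simp only [Nat.factorial]; field_simp; norm_num; ring
      rw [h3]; gcongr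
    have h4 : |u * g| ≤ |g| / (4 * a) := by
      rw [abs_mul, le_div_iff₀ (by positivity)]
      nlinarith [abs_nonneg g]
    calc (u * g) ^ 2 * Real.exp |u * g|
        ≤ u ^ 2 * (32 * a ^ 2 * Real.exp (|g| / (4 * a))) * Real.exp (|g| / (4 * a)) := by
          rw [mul_pow]; gcongr
      _ = u ^ 2 * (32 * a ^ 2) * Real.exp (|g| / (2 * a)) := by
          rw [mul_assoc, mul_assoc (32 * a ^ 2), ← Real.exp_add, ← mul_assoc]
          congr 2; field_simp; ring
      _ ≤ u ^ 2 * (32 * a ^ 2) * Real.exp ((X ω ^ 2 + 1) / (2 * a)) := by gcongr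
      _ = _ := by
          rw [add_div, Real.exp_add]
          ring_nf
  have hB : ∫ ω, Real.exp (1 / (2 * a) * X ω ^ 2) ∂μ ≤ 2 := by
    refine (h.integral_exp_sq_le hL (by positivity) (by rw [← ha']; field_simp; rfl)).trans_eq ?_
    rw [← ha']; field_simp; norm_num
  have hi0 : Integrable (fun ω => u * (X ω ^ 2 - 1)) μ :=
    (hsq.sub (integrable_const _)).const_mul u
  have hi1 : Integrable (fun ω => 1 + u * (X ω ^ 2 - 1)) μ := (integrable_const _).add hi0
  rw [mgf]
  calc _ ≤ ∫ ω, ((1 + u * (X ω ^ 2 - 1)) +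
      u ^ 2 * (32 * a ^ 2 * Real.exp (1 / (2 * a))) * Real.exp (1 / (2 * a) * X ω ^ 2)) ∂μ :=
        integral_mono (h.integrable_exp_sq_sub_one hL hu2) (hi1.add (hint2.const_mul _)) hpt
    _ = 1 + u ^ 2 * (32 * a ^ 2 * Real.exp (1 / (2 * a))) *
          ∫ ω, Real.exp (1 / (2 * a) * X ω ^ 2) ∂μ := by
        rw [integral_add hi1 (hint2.const_mul _), integral_const_mul,
          integral_add (integrable_const _) hi0,
          integral_const_mul, integral_sub hsq (integrable_const _), h.integral_sq]
        simp
    _ ≤ 1 + u ^ 2 * (32 * a ^ 2 * Real.exp (1 / (2 * a))) * 2 := by gcongr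
    _ = 1 + bernConst L * u ^ 2 := by rw [bernConst, ← ha']; ring
    _ ≤ _ := by linarith [Real.add_one_le_exp (bernConst L * u ^ 2)]

/-- The constant in the moment bound for centred sums of squares. -/
def sqConst (L : ℝ) : ℝ := 8 * sqRate L * Real.exp (bernConst L / (16 * sqRate L ^ 2))

lemma sqConst_pos (hL : 0 < L) : 0 < sqConst L := by
  have := sqRate_pos hL
  unfold sqConst; positivity

/-- Bernstein's inequality in the range `q ≤ n` in which the subgaussian part dominates. -/
lemma lintegral_sum_sq_sub_one_pow_le (hL : 0 < L) (hξ : ∀ i, IsStandardSubgaussian L (ξ i) μ)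
    (hind : iIndepFun ξ μ) {b : ι → ℝ} (hb : ∀ i, |b i| ≤ 1) {q : ℕ} (hq : 1 ≤ q)
    (hqn : q ≤ Fintype.card ι) :
    ∫⁻ ω, ‖∑ i, b i * (ξ i ω ^ 2 - 1)‖ₑ ^ q ∂μ ≤
      ENNReal.ofReal (sqConst L * √q * √(Fintype.card ι)) ^ q := by
  have hmeas := fun i => (hξ i).measurable
  have ha := sqRate_pos hL
  set n := Fintype.card ι with hn
  have hq0 : (0 : ℝ) < q := by exact_mod_cast hq
  have hqn' : (q : ℝ) ≤ n := by exact_mod_cast hqn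
  have hn0 : (0 : ℝ) < n := hq0.trans_le hqn'
  set l := √q / √n / (4 * sqRate L) with hl
  have hl0 : 0 < l := by positivity
  have hl1 : 4 * sqRate L * l ≤ 1 := by
    have : √q / √n ≤ 1 := by rw [div_le_one (by positivity)]; exact Real.sqrt_le_sqrt hqn'
    rw [hl]; field_simp; rwa [div_le_one (by positivity)] at this
  have hY : (fun ω => ∑ i, b i * (ξ i ω ^ 2 - 1)) = ∑ i, fun ω => b i * (ξ i ω ^ 2 - 1) := by
    ext ω; simp
  have hind' : iIndepFun (fun i ω => b i * (ξ i ω ^ 2 - 1)) μ :=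
    hind.comp (fun i x => b i * (x ^ 2 - 1)) fun i => by fun_prop
  have hbt : ∀ t, |t| ≤ l → ∀ i, 4 * sqRate L * |t * b i| ≤ 1 := by
    intro t ht i
    rw [abs_mul]
    calc 4 * sqRate L * (|t| * |b i|) ≤ 4 * sqRate L * (l * 1) := by gcongr; exact hb i
      _ ≤ 1 := by rwa [mul_one]
  have hint : ∀ t, |t| ≤ l →
      Integrable (fun ω => Real.exp (t * ∑ i, b i * (ξ i ω ^ 2 - 1))) μ := by
    intro t ht
    have := hind'.integrable_exp_mul_sum (t := t) (fun i => by fun_prop)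
      (s := Finset.univ) fun i _ => by
        simpa only [mul_assoc] using (hξ i).integrable_exp_sq_sub_one hL (u := t * b i) (by
          have := hbt t ht i
          nlinarith [le_abs_self (t * b i), mul_nonneg ha.le (abs_nonneg (t * b i))])
    simpa only [Finset.sum_apply] using this
  have hmgf : ∀ t, |t| ≤ l → mgf (fun ω => ∑ i, b i * (ξ i ω ^ 2 - 1)) μ t ≤
      Real.exp (bernConst L * l ^ 2 * n) := by
    intro t ht
    have hB := bernConst_pos hL
    have : Real.exp (bernConst L * l ^ 2 * n) = ∏ _i : ι, Real.exp (bernConst L * l ^ 2) := by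
      rw [Finset.prod_const, ← Real.exp_nat_mul, Finset.card_univ, ← hn, mul_comm]
    rw [hY, hind'.mgf_sum (fun i => by fun_prop), this]
    refine Finset.prod_le_prod (fun i _ => mgf_nonneg) fun i _ => ?_
    rw [mgf_const_mul (X := fun ω => ξ i ω ^ 2 - 1)]
    refine ((hξ i).mgf_sq_sub_one_le hL (by rw [mul_comm (b i)]; exact hbt t ht i)).trans ?_
    rw [Real.exp_le_exp]
    gcongr 1
    rw [← sq_abs]
    gcongr
    rw [abs_mul]
    calc |b i| * |t| ≤ 1 * l := by gcongr; exact hb i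
      _ = l := one_mul l
  have hl2 : bernConst L * l ^ 2 * n = q * (bernConst L / (16 * sqRate L ^ 2)) := by
    rw [hl, div_pow, div_pow, Real.sq_sqrt hq0.le, Real.sq_sqrt hn0.le]; field_simp; ring
  refine (lintegral_pow_le_of_mgf_le hl0 (hint l (abs_of_pos hl0).le)
    (hint (-l) (by rw [abs_neg, abs_of_pos hl0])) (hmgf l (abs_of_pos hl0).le)
    (hmgf (-l) (by rw [abs_neg, abs_of_pos hl0])) q).trans ?_
  rw [← ENNReal.ofReal_pow (by have := sqConst_pos hL; positivity)]
  apply ENNReal.ofReal_le_ofReal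
  have h1 : (q : ℝ) / l = 4 * sqRate L * (√q * √n) := by
    rw [hl]; field_simp; rw [Real.sq_sqrt hq0.le]
  have h2 : (2 : ℝ) ≤ 2 ^ q := le_self_pow₀ one_le_two (by lia)
  calc 2 * Real.exp (bernConst L * l ^ 2 * n) * (q / l) ^ q
      ≤ 2 ^ q * Real.exp (bernConst L / (16 * sqRate L ^ 2)) ^ q *
        (4 * sqRate L * (√q * √n)) ^ q := by
        rw [hl2, Real.exp_nat_mul, h1]
        gcongr
    _ = _ := by
        rw [← mul_pow, ← mul_pow, sqConst]; congr 1; ring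

/-- The constant in the moment bound for `‖ξ‖²`. -/
def normConst (L κ : ℝ) : ℝ := max 1 κ * (2 * sqRate L) * 3

lemma normConst_pos (hL : 0 < L) (κ : ℝ) : 0 < normConst L κ := by
  have := sqRate_pos hL
  have : 0 < max 1 κ := lt_max_of_lt_left one_pos
  unfold normConst; positivity

/-- For orders `q` up to a multiple of `n`, the `q`-th moment of `‖ξ‖²` is of order `n`. -/
lemma eLpNorm_sum_sq_le (hL : 0 < L) (hξ : ∀ i, IsStandardSubgaussian L (ξ i) μ)
    (hind : iIndepFun ξ μ) {κ : ℝ} {q : ℕ} (hq : 1 ≤ q) (hqn : (q : ℝ) ≤ κ * Fintype.card ι) :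
    eLpNorm (fun ω => ∑ i, ξ i ω ^ 2) q μ ≤
      ENNReal.ofReal (2 * normConst L κ * Fintype.card ι) := by
  have hmeas := fun i => (hξ i).measurable
  have ha := sqRate_pos hL
  set n := Fintype.card ι with hn
  have hq0 : (0 : ℝ) < q := by exact_mod_cast hq
  have hn0 : (0 : ℝ) < n := by
    rcases Nat.eq_zero_or_pos n with h | h
    · rw [h] at hqn; simp at hqn; linarith
    · exact_mod_cast h
  set m := max 1 κ with hm
  have hm1 : 1 ≤ m := le_max_left _ _
  have hqm : (q : ℝ) ≤ m * n := hqn.trans (by gcongr; exact le_max_right _ _)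
  set l := q / (m * n) / (2 * sqRate L) with hl
  have hl0 : 0 < l := by positivity
  have hl1 : 2 * sqRate L * l ≤ 1 := by
    have : q / (m * n) ≤ 1 := by rw [div_le_one (by positivity)]; exact hqm
    rw [hl, mul_div_cancel₀ _ (by positivity)]; exact this
  have hY : (fun ω => ∑ i, ξ i ω ^ 2) = ∑ i, fun ω => ξ i ω ^ 2 := by
    ext ω; simp
  have hind' : iIndepFun (fun i ω => ξ i ω ^ 2) μ :=
    hind.comp (fun i x => x ^ 2) fun i => by fun_prop
  have hint : ∀ t, t ≤ l → Integrable (fun ω => Real.exp (t * ∑ i, ξ i ω ^ 2)) μ := by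
    intro t ht
    have := hind'.integrable_exp_mul_sum (t := t) (fun i => by fun_prop)
      (s := Finset.univ) fun i _ => (hξ i).integrable_exp_sq hL (u := t) (by nlinarith)
    simpa only [Finset.sum_apply] using this
  have hmgf : mgf (fun ω => ∑ i, ξ i ω ^ 2) μ l ≤ Real.exp q := by
    have h1 : Real.exp (2 * sqRate L * l * n) = ∏ _i : ι, Real.exp (2 * sqRate L * l) := by
      rw [Finset.prod_const, ← Real.exp_nat_mul, Finset.card_univ, ← hn, mul_comm]
    have h2 : 2 * sqRate L * l * n ≤ q := by
      rw [hl, mul_div_cancel₀ _ (by positivity), div_mul_eq_mul_div, div_le_iff₀ (by positivity)]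
      nlinarith [mul_pos hq0 hn0]
    refine le_trans ?_ (Real.exp_le_exp.2 h2)
    rw [hY, hind'.mgf_sum (fun i => by fun_prop), h1]
    refine Finset.prod_le_prod (fun i _ => mgf_nonneg) fun i _ => ?_
    refine ((hξ i).integral_exp_sq_le hL hl0.le hl1).trans ?_
    linarith [Real.add_one_le_exp (2 * sqRate L * l)]
  have hmgf' : mgf (fun ω => ∑ i, ξ i ω ^ 2) μ (-l) ≤ Real.exp q := by
    refine le_trans ?_ hmgf
    refine integral_mono (hint _ (by linarith)) (hint _ le_rfl) fun ω => ?_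
    have : 0 ≤ ∑ i, ξ i ω ^ 2 := Finset.sum_nonneg fun i _ => sq_nonneg _
    simp only [Real.exp_le_exp]
    nlinarith
  refine eLpNorm_le_of_lintegral_pow_le (by lia) ((lintegral_pow_le_of_mgf_le hl0 (hint l le_rfl)
    (hint (-l) (by linarith)) hmgf hmgf' q).trans ?_)
  rw [← ENNReal.ofReal_pow (by have := normConst_pos hL κ; positivity)]
  apply ENNReal.ofReal_le_ofReal
  have h1 : (q : ℝ) / l = m * (2 * sqRate L) * n := by
    rw [hl]; field_simp
  have h2 : (2 : ℝ) ≤ 2 ^ q := le_self_pow₀ one_le_two (by lia)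
  have h3 : Real.exp q ≤ 3 ^ q := by
    rw [← mul_one (q : ℝ), Real.exp_nat_mul]
    gcongr
    exact Real.exp_one_lt_d9.le.trans (by norm_num)
  calc 2 * Real.exp q * (q / l) ^ q ≤ 2 ^ q * 3 ^ q * (m * (2 * sqRate L) * n) ^ q := by
        rw [h1]; gcongr
    _ = _ := by
        rw [← mul_pow, ← mul_pow, normConst]; congr 1; ring

end Vector

/-! ### Suprema over finite families of increasing size -/

lemma sup_pow_le_of_forall {κ : Type*} {T : Finset κ} {f : κ → ℝ≥0} {p : ℕ} (hp : p ≠ 0) {B : ℝ≥0}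
    (h : ∀ a ∈ T, f a ^ p ≤ B) : T.sup f ^ p ≤ B := by
  refine Finset.sup_induction (p := fun z => z ^ p ≤ B) (by simp [hp]) ?_ h
  intro a ha b hb
  rcases le_total a b with hab | hab
  · rwa [sup_eq_right.2 hab]
  · rwa [sup_eq_left.2 hab]

lemma sum_half_pow_two_pow_le (s₀ s₁ : ℕ) :
    ∑ s ∈ Finset.Icc s₀ s₁, ((1 : ℝ≥0∞) / 2) ^ 2 ^ s ≤ 1 := by
  have h : ∀ s : ℕ, ((1 : ℝ≥0∞) / 2) ^ 2 ^ s ≤ (2⁻¹ : ℝ≥0∞) ^ (s + 1) := fun s => by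
    rw [one_div]
    exact pow_le_pow_right_of_le_one' (by simp) Nat.lt_two_pow_self
  calc _ ≤ ∑ s ∈ Finset.Icc s₀ s₁, (2⁻¹ : ℝ≥0∞) ^ (s + 1) := Finset.sum_le_sum fun s _ => h s
    _ ≤ ∑' s : ℕ, (2⁻¹ : ℝ≥0∞) ^ (s + 1) := ENNReal.sum_le_tsum _
    _ = 1 := by
      rw [ENNReal.tsum_geometric_add_one, ENNReal.one_sub_inv_two]
      exact ENNReal.mul_inv_cancel (by simp) (by simp)

/-- The union bound behind chaining: if the `s`-th family has at most `N ^ 2 ^ s` members, all with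
`2 ^ s`-th moment at most `c`, then the supremum of all of them has a `2 ^ s₀`-th moment of order
`c`, because `u ^ 2 ^ s₀ ≤ 1 + u ^ 2 ^ s` for `s ≥ s₀`. -/
lemma lintegral_sup_pow_le {Ω : Type*} [MeasurableSpace Ω] {μ : Measure Ω} [IsProbabilityMeasure μ]
    {κ : Type*} (T : ℕ → Finset κ) (s₀ s₁ : ℕ) {N : ℕ} (hN : 0 < N)
    (hT : ∀ s ∈ Finset.Icc s₀ s₁, (T s).card ≤ N ^ 2 ^ s) {Z : ℕ → κ → Ω → ℝ≥0}
    (hZm : ∀ s τ, Measurable (Z s τ)) {c : ℝ≥0}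
    (hZ : ∀ s ∈ Finset.Icc s₀ s₁, ∀ τ ∈ T s,
      ∫⁻ ω, (Z s τ ω : ℝ≥0∞) ^ 2 ^ s ∂μ ≤ (c : ℝ≥0∞) ^ 2 ^ s) :
    ∫⁻ ω, (((Finset.Icc s₀ s₁).sup fun s => (T s).sup fun τ => Z s τ ω : ℝ≥0) : ℝ≥0∞) ^ 2 ^ s₀ ∂μ ≤
      2 * (2 * N * c : ℝ≥0∞) ^ 2 ^ s₀ := by
  have hp : ∀ s : ℕ, 2 ^ s ≠ 0 := fun s => by positivity
  rcases eq_or_ne c 0 with rfl | hc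
  · have hae : ∀ᵐ ω ∂μ, ∀ s ∈ Finset.Icc s₀ s₁, ∀ τ ∈ T s, Z s τ ω = 0 := by
      rw [Finset.eventually_all]
      intro s hs
      rw [Finset.eventually_all]
      intro τ hτ
      have h0 : ∫⁻ ω, (Z s τ ω : ℝ≥0∞) ^ 2 ^ s ∂μ = 0 := by
        simpa [hp s] using hZ s hs τ hτ
      have hm := hZm s τ
      rw [lintegral_eq_zero_iff (by fun_prop)] at h0
      filter_upwards [h0] with ω hω
      simpa [hp s] using hω
    have hz : ∫⁻ ω, (((Finset.Icc s₀ s₁).sup fun s => (T s).sup fun τ => Z s τ ω : ℝ≥0) : ℝ≥0∞)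
        ^ 2 ^ s₀ ∂μ = ∫⁻ _, 0 ∂μ := by
      refine lintegral_congr_ae ?_
      filter_upwards [hae] with ω hω
      have : ((Finset.Icc s₀ s₁).sup fun s => (T s).sup fun τ => Z s τ ω) = 0 := by
        rw [← bot_eq_zero, Finset.sup_eq_bot_iff]
        intro s hs
        rw [Finset.sup_eq_bot_iff]
        exact hω s hs
      simp [this]
    rw [hz]; simp
  · set K : ℝ≥0 := 2 * N * c with hK
    have hN0 : (N : ℝ≥0) ≠ 0 := by exact_mod_cast hN.ne'
    have hK0 : K ≠ 0 := by positivity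
    have hpt : ∀ ω, ((Finset.Icc s₀ s₁).sup fun s => (T s).sup fun τ => Z s τ ω) ^ 2 ^ s₀ ≤
        K ^ 2 ^ s₀ * (1 + ∑ s ∈ Finset.Icc s₀ s₁, ∑ τ ∈ T s, (Z s τ ω / K) ^ 2 ^ s) := by
      intro ω
      refine sup_pow_le_of_forall (hp s₀) fun s hs => sup_pow_le_of_forall (hp s₀) fun τ hτ => ?_
      have h1 : (Z s τ ω / K) ^ 2 ^ s₀ ≤ 1 + (Z s τ ω / K) ^ 2 ^ s := by
        rcases le_total (Z s τ ω / K) 1 with h | h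
        · exact (pow_le_one' h _).trans le_self_add
        · exact (pow_le_pow_right₀ h (Nat.pow_le_pow_right two_pos (Finset.mem_Icc.1 hs).1)).trans
            le_add_self
      have h2 : (Z s τ ω / K) ^ 2 ^ s ≤ ∑ s ∈ Finset.Icc s₀ s₁, ∑ τ ∈ T s, (Z s τ ω / K) ^ 2 ^ s :=
        (Finset.single_le_sum (f := fun τ => (Z s τ ω / K) ^ 2 ^ s) (fun _ _ => zero_le) hτ).trans
          (Finset.single_le_sum (f := fun s => ∑ τ ∈ T s, (Z s τ ω / K) ^ 2 ^ s)
            (fun _ _ => zero_le) hs)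
      calc Z s τ ω ^ 2 ^ s₀ = K ^ 2 ^ s₀ * (Z s τ ω / K) ^ 2 ^ s₀ := by
            rw [← mul_pow, mul_div_cancel₀ _ hK0]
        _ ≤ _ := by gcongr; exact h1.trans (by gcongr)
    have hterm : ∀ s ∈ Finset.Icc s₀ s₁, ∀ τ ∈ T s,
        ∫⁻ ω, ((Z s τ ω / K : ℝ≥0) : ℝ≥0∞) ^ 2 ^ s ∂μ ≤ (1 / (2 * N)) ^ 2 ^ s := by
      intro s hs τ hτ
      have hm := hZm s τ
      have h1 : ∀ ω, ((Z s τ ω / K : ℝ≥0) : ℝ≥0∞) ^ 2 ^ s =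
          ((K : ℝ≥0∞)⁻¹) ^ 2 ^ s * (Z s τ ω : ℝ≥0∞) ^ 2 ^ s := fun ω => by
        rw [ENNReal.coe_div hK0, div_eq_mul_inv, mul_comm, mul_pow]
      simp_rw [h1]
      rw [lintegral_const_mul _ (by fun_prop)]
      calc _ ≤ ((K : ℝ≥0∞)⁻¹) ^ 2 ^ s * (c : ℝ≥0∞) ^ 2 ^ s := by gcongr; exact hZ s hs τ hτ
        _ = ((c / K : ℝ≥0) : ℝ≥0∞) ^ 2 ^ s := by
            rw [ENNReal.coe_div hK0, div_eq_mul_inv, mul_comm, mul_pow]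
        _ = ((1 / (2 * N) : ℝ≥0) : ℝ≥0∞) ^ 2 ^ s := by
            congr 2; rw [hK]; field_simp
        _ = _ := by
            rw [ENNReal.coe_div (by positivity)]; simp
    calc _ ≤ ∫⁻ ω, (K : ℝ≥0∞) ^ 2 ^ s₀ *
          (1 + ∑ s ∈ Finset.Icc s₀ s₁, ∑ τ ∈ T s, ((Z s τ ω / K : ℝ≥0) : ℝ≥0∞) ^ 2 ^ s) ∂μ :=
          lintegral_mono fun ω => by
            simpa only [ENNReal.coe_pow, ENNReal.coe_mul, ENNReal.coe_add, ENNReal.coe_one,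
              ENNReal.ofNNReal_finsetSum] using ENNReal.coe_le_coe.2 (hpt ω)
      _ = (K : ℝ≥0∞) ^ 2 ^ s₀ * (1 + ∑ s ∈ Finset.Icc s₀ s₁, ∑ τ ∈ T s,
          ∫⁻ ω, ((Z s τ ω / K : ℝ≥0) : ℝ≥0∞) ^ 2 ^ s ∂μ) := by
          rw [lintegral_const_mul _ (by fun_prop), lintegral_add_left (by fun_prop),
            lintegral_finsetSum _ (by fun_prop)]
          simp_rw [fun s => lintegral_finsetSum (μ := μ) (T s)
            (f := fun τ ω => ((Z s τ ω / K : ℝ≥0) : ℝ≥0∞) ^ 2 ^ s) (by fun_prop)]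
          simp
      _ ≤ (K : ℝ≥0∞) ^ 2 ^ s₀ * (1 + ∑ s ∈ Finset.Icc s₀ s₁, (1 / 2) ^ 2 ^ s) := by
          gcongr with s hs
          calc _ ≤ ∑ τ ∈ T s, ((1 : ℝ≥0∞) / (2 * N)) ^ 2 ^ s := Finset.sum_le_sum (hterm s hs)
            _ = (T s).card * ((1 : ℝ≥0∞) / (2 * N)) ^ 2 ^ s := by simp
            _ ≤ (N : ℝ≥0∞) ^ 2 ^ s * ((1 : ℝ≥0∞) / (2 * N)) ^ 2 ^ s := by
                gcongr; exact_mod_cast hT s hs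
            _ = _ := by
                rw [← mul_pow]; congr 1
                rw [one_div, ENNReal.mul_inv (by simp) (by simp), mul_left_comm,
                  ENNReal.mul_inv_cancel (by exact_mod_cast hN.ne') (by simp), one_div, mul_one]
      _ ≤ (K : ℝ≥0∞) ^ 2 ^ s₀ * (1 + 1) := by gcongr; exact sum_half_pow_two_pow_le s₀ s₁
      _ = _ := by rw [hK, one_add_one_eq_two, mul_comm]; push_cast; rfl

/-! ### Decoupling -/

section Decoupling

variable {ι : Type*} {H : Type*} [NormedAddCommGroup H] [InnerProductSpace ℝ H]

/-- Averaging `‖∑ ± vᵢ‖²` over all signs. -/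
lemma sum_powerset_norm_sub_sq [DecidableEq ι] (v : ι → H) (s : Finset ι) :
    ∑ I ∈ s.powerset, ‖∑ i ∈ I, v i - ∑ i ∈ s \ I, v i‖ ^ 2 = 2 ^ s.card * ∑ i ∈ s, ‖v i‖ ^ 2 := by
  induction s using Finset.induction_on with
  | empty => simp
  | insert a s ha ih =>
    rw [Finset.sum_powerset_insert ha, Finset.card_insert_of_notMem ha, Finset.sum_insert ha]
    rw [← Finset.sum_add_distrib]
    have key : ∀ I ∈ s.powerset, ‖∑ i ∈ I, v i - ∑ i ∈ insert a s \ I, v i‖ ^ 2 +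
        ‖∑ i ∈ insert a I, v i - ∑ i ∈ insert a s \ insert a I, v i‖ ^ 2 =
        2 * (‖∑ i ∈ I, v i - ∑ i ∈ s \ I, v i‖ ^ 2 + ‖v a‖ ^ 2) := by
      intro I hI
      have haI : a ∉ I := fun h => ha (Finset.mem_powerset.1 hI h)
      have h1 : insert a s \ I = insert a (s \ I) := Finset.insert_sdiff_of_notMem _ haI
      have h2 : insert a s \ insert a I = s \ I := by
        ext i; simp only [Finset.mem_sdiff, Finset.mem_insert]; grind
      rw [h1, h2, Finset.sum_insert haI, Finset.sum_insert (by simp [ha])]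
      have := parallelogram_law_with_norm ℝ (∑ i ∈ I, v i - ∑ i ∈ s \ I, v i) (v a)
      rw [show ∑ i ∈ I, v i - (v a + ∑ i ∈ s \ I, v i) =
        ∑ i ∈ I, v i - ∑ i ∈ s \ I, v i - v a by abel,
        show v a + ∑ i ∈ I, v i - ∑ i ∈ s \ I, v i =
        ∑ i ∈ I, v i - ∑ i ∈ s \ I, v i + v a by abel]
      linarith
    rw [Finset.sum_congr rfl key, ← Finset.mul_sum, Finset.sum_add_distrib, ih]
    simp only [Finset.sum_const, Finset.card_powerset, nsmul_eq_mul]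
    push_cast
    ring

/-- The decoupling identity: the off-diagonal part of `‖∑ vᵢ‖²` is four times the average of
`⟪∑_{i ∈ I} vᵢ, ∑_{i ∉ I} vᵢ⟫` over all subsets `I`. -/
lemma norm_sum_sq_eq_sum_add_average [DecidableEq ι] (v : ι → H) (s : Finset ι) :
    ‖∑ i ∈ s, v i‖ ^ 2 = ∑ i ∈ s, ‖v i‖ ^ 2 +
      (2 ^ s.card : ℝ)⁻¹ * ∑ I ∈ s.powerset, 4 * inner ℝ (∑ i ∈ I, v i) (∑ i ∈ s \ I, v i) := by
  have key : ∀ I ∈ s.powerset, 4 * inner ℝ (∑ i ∈ I, v i) (∑ i ∈ s \ I, v i) =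
      ‖∑ i ∈ s, v i‖ ^ 2 - ‖∑ i ∈ I, v i - ∑ i ∈ s \ I, v i‖ ^ 2 := by
    intro I hI
    rw [← Finset.sum_sdiff (Finset.mem_powerset.1 hI), add_comm, norm_add_sq_real,
      norm_sub_sq_real]
    ring
  rw [Finset.sum_congr rfl key, Finset.sum_sub_distrib, sum_powerset_norm_sub_sq]
  simp only [Finset.sum_const, Finset.card_powerset, nsmul_eq_mul]
  push_cast
  field_simp
  ring

/-- The restriction of a vector to the coordinates in `I`, extended by zero. -/
def mask (I : Finset ι) (x : ι → ℝ) : EuclideanSpace ℝ ι :=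
  WithLp.toLp 2 ((I : Set ι).indicator x)

lemma mask_eq_sum [DecidableEq ι] (I : Finset ι) (x : ι → ℝ) :
    mask I x = ∑ i ∈ I, x i • EuclideanSpace.single i (1 : ℝ) := by
  ext j
  simp [mask, Set.indicator_apply, Finset.sum_apply, Pi.single_apply]

lemma map_mask [Fintype ι] [DecidableEq ι] (A : EuclideanSpace ℝ ι →L[ℝ] H) (I : Finset ι)
    (x : ι → ℝ) : A (mask I x) = ∑ i ∈ I, x i • A (EuclideanSpace.single i 1) := by
  rw [mask_eq_sum, map_sum]
  simp

lemma measurable_mask (I : Finset ι) : Measurable (mask I : (ι → ℝ) → EuclideanSpace ℝ ι) := by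
  have h : Measurable fun x : ι → ℝ => (I : Set ι).indicator x := by
    refine measurable_pi_lambda _ fun i => ?_
    by_cases hi : i ∈ (I : Set ι)
    · simpa only [Set.indicator_of_mem hi] using measurable_pi_apply i
    · simp only [Set.indicator_of_notMem hi, measurable_const]
  exact (WithLp.measurable_toLp 2 _).comp h

lemma norm_mask_sq_le [Fintype ι] (I : Finset ι) (x : ι → ℝ) : ‖mask I x‖ ^ 2 ≤ ∑ i, x i ^ 2 := by
  rw [EuclideanSpace.norm_sq_eq]
  refine Finset.sum_le_sum fun i _ => ?_
  by_cases hi : i ∈ (I : Set ι)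
  · simp [mask, Set.indicator_of_mem hi]
  · simp [mask, Set.indicator_of_notMem hi, sq_nonneg]

variable {Ω : Type*} [MeasurableSpace Ω] {μ : Measure Ω} {ξ : ι → Ω → ℝ}

lemma indepFun_mask (hξ : ∀ i, Measurable (ξ i)) (hind : iIndepFun ξ μ) {I J : Finset ι}
    (hIJ : Disjoint I J) :
    IndepFun (fun ω => mask I fun i => ξ i ω) (fun ω => mask J fun i => ξ i ω) μ := by
  have hext : ∀ I : Finset ι, ∃ f : (I → ℝ) → EuclideanSpace ℝ ι, Measurable f ∧
      ∀ ω, (mask I fun i => ξ i ω) = f fun i : I => ξ i ω := by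
    intro I
    classical
    refine ⟨fun z => WithLp.toLp 2 fun i => if h : i ∈ I then z ⟨i, h⟩ else 0, ?_, fun ω => ?_⟩
    · refine (WithLp.measurable_toLp 2 _).comp (measurable_pi_lambda _ fun i => ?_)
      by_cases hi : i ∈ I
      · simp only [hi, dif_pos]; exact measurable_pi_apply _
      · simp only [hi, dif_neg, not_false_eq_true, measurable_const]
    · ext i
      simp [mask, Set.indicator_apply]
  obtain ⟨f, hf, hf'⟩ := hext I
  obtain ⟨g, hg, hg'⟩ := hext J
  simp_rw [hf', hg']
  exact (hind.indepFun_finset I J hIJ hξ).comp hf hg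

/-- Two disjoint blocks of coordinates may be integrated one after the other. -/
lemma lintegral_mask_mask [IsProbabilityMeasure μ] (hξ : ∀ i, Measurable (ξ i))
    (hind : iIndepFun ξ μ) {I J : Finset ι} (hIJ : Disjoint I J)
    {f : EuclideanSpace ℝ ι × EuclideanSpace ℝ ι → ℝ≥0∞} (hf : Measurable f) :
    ∫⁻ ω, f (mask I fun i => ξ i ω, mask J fun i => ξ i ω) ∂μ =
      ∫⁻ ω', ∫⁻ ω, f (mask I fun i => ξ i ω, mask J fun i => ξ i ω') ∂μ ∂μ := by
  have hI : Measurable fun ω => mask I fun i => ξ i ω :=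
    (measurable_mask I).comp (measurable_pi_lambda _ hξ)
  have hJ : Measurable fun ω => mask J fun i => ξ i ω :=
    (measurable_mask J).comp (measurable_pi_lambda _ hξ)
  have h := (indepFun_iff_map_prod_eq_prod_map_map hI.aemeasurable hJ.aemeasurable).1
    (indepFun_mask hξ hind hIJ)
  have hpm := Measure.isProbabilityMeasure_map (μ := μ) hI.aemeasurable
  have hpm' := Measure.isProbabilityMeasure_map (μ := μ) hJ.aemeasurable
  rw [← lintegral_map (f := f) hf (hI.prodMk hJ), h, lintegral_prod_symm _ hf.aemeasurable,
    lintegral_map (hf.lintegral_prod_left') hJ]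
  refine lintegral_congr fun ω' => ?_
  rw [lintegral_map (by fun_prop) hI]

end Decoupling

/-! ### The decoupled chaos process -/

section Chaos

variable {ι : Type*} {H : Type*} [NormedAddCommGroup H] [InnerProductSpace ℝ H]
  {Ω : Type*} [MeasurableSpace Ω] {μ : Measure Ω} [IsProbabilityMeasure μ]
  {ξ : ι → Ω → ℝ} {L : ℝ}

/-- `sup_{A ∈ G} ‖A y‖`. -/
def supNorm (G : Finset (EuclideanSpace ℝ ι →L[ℝ] H)) (y : EuclideanSpace ℝ ι) : ℝ≥0 :=
  G.sup fun A => ‖A y‖₊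

lemma norm_apply_le_supNorm {G : Finset (EuclideanSpace ℝ ι →L[ℝ] H)}
    {A : EuclideanSpace ℝ ι →L[ℝ] H} (hA : A ∈ G) (y : EuclideanSpace ℝ ι) :
    ‖A y‖ ≤ supNorm G y :=
  NNReal.coe_le_coe.2 (Finset.le_sup (f := fun A : EuclideanSpace ℝ ι →L[ℝ] H => ‖A y‖₊) hA)

lemma continuous_supNorm (G : Finset (EuclideanSpace ℝ ι →L[ℝ] H)) : Continuous (supNorm G) :=
  Continuous.finset_sup_apply fun A _ => by fun_prop

variable [Fintype ι]

/-- The supremum of `|⟪D x, E y⟫| / (2 ^ (s / 2) ‖D‖)` over all levels `s₀ ≤ s ≤ s₁` and all pairs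
`(D, E)` in the family `T s`. Pairs with `D = 0` contribute `0`. -/
def bilSup (T : ℕ → Finset ((EuclideanSpace ℝ ι →L[ℝ] H) × (EuclideanSpace ℝ ι →L[ℝ] H)))
    (s₀ s₁ : ℕ) (x y : EuclideanSpace ℝ ι) : ℝ≥0 :=
  (Finset.Icc s₀ s₁).sup fun s => (T s).sup fun τ =>
    ‖(inner ℝ (τ.1 x) (τ.2 y) : ℝ)‖₊ / (NNReal.sqrt (2 ^ s) * ‖τ.1‖₊)

lemma continuous_bilSup
    (T : ℕ → Finset ((EuclideanSpace ℝ ι →L[ℝ] H) × (EuclideanSpace ℝ ι →L[ℝ] H))) (s₀ s₁ : ℕ) :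
    Continuous fun z : EuclideanSpace ℝ ι × EuclideanSpace ℝ ι => bilSup T s₀ s₁ z.1 z.2 :=
  Continuous.finset_sup_apply fun s _ => Continuous.finset_sup_apply fun τ _ =>
    Continuous.div_const (by fun_prop) _

lemma abs_inner_le_bilSup
    {T : ℕ → Finset ((EuclideanSpace ℝ ι →L[ℝ] H) × (EuclideanSpace ℝ ι →L[ℝ] H))} {s₀ s₁ s : ℕ}
    (hs : s ∈ Finset.Icc s₀ s₁) {D E : EuclideanSpace ℝ ι →L[ℝ] H} (h : (D, E) ∈ T s)
    (x y : EuclideanSpace ℝ ι) :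
    |inner ℝ (D x) (E y)| ≤ √(2 ^ s) * ‖D‖ * bilSup T s₀ s₁ x y := by
  rcases eq_or_ne D 0 with rfl | hD
  · simp
  have h1 : ‖(inner ℝ (D x) (E y) : ℝ)‖₊ / (NNReal.sqrt (2 ^ s) * ‖D‖₊) ≤ bilSup T s₀ s₁ x y :=
    (Finset.le_sup (f := fun τ : (EuclideanSpace ℝ ι →L[ℝ] H) × (EuclideanSpace ℝ ι →L[ℝ] H) =>
      ‖(inner ℝ (τ.1 x) (τ.2 y) : ℝ)‖₊ / (NNReal.sqrt (2 ^ s) * ‖τ.1‖₊)) h).trans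
      (Finset.le_sup (f := fun s => (T s).sup fun τ =>
        ‖(inner ℝ (τ.1 x) (τ.2 y) : ℝ)‖₊ / (NNReal.sqrt (2 ^ s) * ‖τ.1‖₊)) hs)
  have hD' : 0 < ‖D‖ := norm_pos_iff.2 hD
  have h2 := NNReal.coe_le_coe.2 h1
  push_cast at h2
  rw [div_le_iff₀ (by positivity), Real.norm_eq_abs] at h2
  linarith

/-- `⟪D ξ_I, w⟫` is a linear form in `ξ` with coefficient vector of norm at most `‖D‖ ‖w‖`. -/
lemma exists_coeff (D : EuclideanSpace ℝ ι →L[ℝ] H) (w : H) (I : Finset ι) :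
    ∃ a : ι → ℝ, √(∑ i, a i ^ 2) ≤ ‖D‖ * ‖w‖ ∧
      ∀ x : ι → ℝ, inner ℝ (D (mask I x)) w = ∑ i, a i * x i := by
  set z := (InnerProductSpace.toDual ℝ (EuclideanSpace ℝ ι)).symm ((innerSL ℝ w).comp D) with hz
  have hz1 : ‖z‖ ≤ ‖D‖ * ‖w‖ := by
    rw [hz, LinearIsometryEquiv.norm_map, mul_comm]
    refine (ContinuousLinearMap.opNorm_comp_le _ _).trans ?_
    rw [innerSL_apply_norm]
  refine ⟨(I : Set ι).indicator z, ?_, fun x => ?_⟩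
  · refine le_trans ?_ hz1
    rw [EuclideanSpace.norm_eq]
    refine Real.sqrt_le_sqrt (Finset.sum_le_sum fun i _ => ?_)
    by_cases hi : i ∈ (I : Set ι)
    · simp [Set.indicator_of_mem hi]
    · simp [Set.indicator_of_notMem hi, sq_nonneg]
  · have h1 : inner ℝ z (mask I x) = inner ℝ w (D (mask I x)) := by
      rw [hz, InnerProductSpace.toDual_symm_apply]; simp
    rw [real_inner_comm, ← h1, PiLp.inner_apply]
    refine Finset.sum_congr rfl fun i _ => ?_
    by_cases hi : i ∈ (I : Set ι)
    · simp [mask, Set.indicator_of_mem hi, mul_comm]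
    · simp [mask, Set.indicator_of_notMem hi]

/-- Chaining conditionally on the second argument `y` of the decoupled process. -/
lemma lintegral_bilSup_pow_le (hL : 0 < L) (hξ : ∀ i, IsStandardSubgaussian L (ξ i) μ)
    (hind : iIndepFun ξ μ)
    {T : ℕ → Finset ((EuclideanSpace ℝ ι →L[ℝ] H) × (EuclideanSpace ℝ ι →L[ℝ] H))} {s₀ s₁ N : ℕ}
    (hN : 0 < N) (hT : ∀ s ∈ Finset.Icc s₀ s₁, (T s).card ≤ N ^ 2 ^ s)
    {G : Finset (EuclideanSpace ℝ ι →L[ℝ] H)}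
    (hG : ∀ s ∈ Finset.Icc s₀ s₁, ∀ τ ∈ T s, τ.2 ∈ G) (I : Finset ι) (y : EuclideanSpace ℝ ι) :
    ∫⁻ ω, (bilSup T s₀ s₁ (mask I fun i => ξ i ω) y : ℝ≥0∞) ^ 2 ^ s₀ ∂μ ≤
      (ENNReal.ofReal (4 * N * linConst L) * (supNorm G y : ℝ≥0∞)) ^ 2 ^ s₀ := by
  have hmeas := fun i => (hξ i).measurable
  have hC := linConst_pos L
  have hmask : Measurable fun ω => mask I fun i => ξ i ω :=
    (measurable_mask I).comp (measurable_pi_lambda _ hmeas)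
  have hZ : ∀ s ∈ Finset.Icc s₀ s₁, ∀ τ ∈ T s,
      ∫⁻ ω, ((‖(inner ℝ (τ.1 (mask I fun i => ξ i ω)) (τ.2 y) : ℝ)‖₊ /
        (NNReal.sqrt (2 ^ s) * ‖τ.1‖₊) : ℝ≥0) : ℝ≥0∞) ^ 2 ^ s ∂μ ≤
      ((Real.toNNReal (linConst L) * supNorm G y : ℝ≥0) : ℝ≥0∞) ^ 2 ^ s := by
    intro s hs τ hτ
    rcases eq_or_ne τ.1 0 with hD | hD
    · simp [hD]
    have hD0 : ‖τ.1‖₊ ≠ 0 := by simpa using hD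
    obtain ⟨a, ha, ha'⟩ := exists_coeff τ.1 (τ.2 y) I
    have hlin := lintegral_linear_pow_le hL hξ hind a (q := 2 ^ s) Nat.one_le_two_pow
    set W : ℝ≥0 := NNReal.sqrt (2 ^ s) * ‖τ.1‖₊ with hW
    have hW0 : W ≠ 0 := by positivity
    have hS : ‖τ.2 y‖₊ ≤ supNorm G y := norm_apply_le_supNorm (hG s hs τ hτ) y
    have h1 : ∀ ω, ((‖(inner ℝ (τ.1 (mask I fun i => ξ i ω)) (τ.2 y) : ℝ)‖₊ / W : ℝ≥0) : ℝ≥0∞)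
        ^ 2 ^ s = ((W : ℝ≥0∞)⁻¹) ^ 2 ^ s * ‖∑ i, a i * ξ i ω‖ₑ ^ 2 ^ s := fun ω => by
      rw [ha', ENNReal.coe_div hW0, div_eq_mul_inv, mul_comm, mul_pow]; rfl
    simp_rw [h1]
    rw [lintegral_const_mul _ (by fun_prop)]
    calc _ ≤ ((W : ℝ≥0∞)⁻¹) ^ 2 ^ s *
          ENNReal.ofReal (linConst L * √(2 ^ s : ℕ) * (‖τ.1‖ * ‖τ.2 y‖)) ^ 2 ^ s := by
          gcongr
          refine hlin.trans ?_
          gcongr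
      _ = ((Real.toNNReal (linConst L) * ‖τ.2 y‖₊ : ℝ≥0) : ℝ≥0∞) ^ 2 ^ s := by
          rw [← mul_pow]
          congr 1
          have h2 : ENNReal.ofReal (linConst L * √(2 ^ s : ℕ) * (‖τ.1‖ * ‖τ.2 y‖)) =
              ((W * (Real.toNNReal (linConst L) * ‖τ.2 y‖₊) : ℝ≥0) : ℝ≥0∞) := by
            rw [ENNReal.ofReal]
            congr 1
            ext
            rw [Real.coe_toNNReal _ (by positivity), hW]
            push_cast
            rw [Real.coe_toNNReal _ hC.le]
            ring
          rw [h2, ENNReal.coe_mul W, ← mul_assoc,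
            ENNReal.inv_mul_cancel (by exact_mod_cast hW0) (by simp), one_mul]
      _ ≤ _ := by
          gcongr
  have hsup := lintegral_sup_pow_le T s₀ s₁ hN hT
    (Z := fun s τ ω => ‖(inner ℝ (τ.1 (mask I fun i => ξ i ω)) (τ.2 y) : ℝ)‖₊ /
      (NNReal.sqrt (2 ^ s) * ‖τ.1‖₊))
    (fun s τ => by
      have : Continuous fun x : EuclideanSpace ℝ ι => ‖(inner ℝ (τ.1 x) (τ.2 y) : ℝ)‖₊ /
        (NNReal.sqrt (2 ^ s) * ‖τ.1‖₊) := Continuous.div_const (by fun_prop) _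
      exact this.measurable.comp hmask) hZ
  refine hsup.trans ?_
  have h2 : (2 : ℝ≥0∞) ≤ 2 ^ 2 ^ s₀ := le_self_pow₀ one_le_two (by positivity)
  calc _ ≤ (2 : ℝ≥0∞) ^ 2 ^ s₀ *
        (2 * N * (Real.toNNReal (linConst L) * supNorm G y : ℝ≥0)) ^ 2 ^ s₀ := by gcongr
    _ = _ := by
        rw [← mul_pow]
        congr 1
        rw [ENNReal.ofReal_mul (by positivity), ENNReal.ofReal_mul (by norm_num), ENNReal.coe_mul,
          ENNReal.ofReal_natCast, ENNReal.ofReal_ofNat, ENNReal.ofReal]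
        ring

lemma eLpNorm_bilSup_le (hL : 0 < L) (hξ : ∀ i, IsStandardSubgaussian L (ξ i) μ)
    (hind : iIndepFun ξ μ)
    {T : ℕ → Finset ((EuclideanSpace ℝ ι →L[ℝ] H) × (EuclideanSpace ℝ ι →L[ℝ] H))} {s₀ s₁ N : ℕ}
    (hN : 0 < N) (hT : ∀ s ∈ Finset.Icc s₀ s₁, (T s).card ≤ N ^ 2 ^ s)
    {G : Finset (EuclideanSpace ℝ ι →L[ℝ] H)}
    (hG : ∀ s ∈ Finset.Icc s₀ s₁, ∀ τ ∈ T s, τ.2 ∈ G) {I J : Finset ι} (hIJ : Disjoint I J) :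
    eLpNorm (fun ω => (bilSup T s₀ s₁ (mask I fun i => ξ i ω) (mask J fun i => ξ i ω) : ℝ))
        (2 ^ s₀ : ℕ) μ ≤
      ENNReal.ofReal (4 * N * linConst L) *
        eLpNorm (fun ω => (supNorm G (mask J fun i => ξ i ω) : ℝ)) (2 ^ s₀ : ℕ) μ := by
  have hmeas := fun i => (hξ i).measurable
  have hq : 2 ^ s₀ ≠ 0 := by positivity
  have hJ : Measurable fun ω => mask J fun i => ξ i ω :=
    (measurable_mask J).comp (measurable_pi_lambda _ hmeas)
  have hS : Measurable fun ω => supNorm G (mask J fun i => ξ i ω) :=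
    (continuous_supNorm G).measurable.comp hJ
  rw [← ENNReal.pow_le_pow_left_iff hq, mul_pow, eLpNorm_coe_pow_eq hq, eLpNorm_coe_pow_eq hq]
  have hf : Measurable fun z : EuclideanSpace ℝ ι × EuclideanSpace ℝ ι =>
      (bilSup T s₀ s₁ z.1 z.2 : ℝ≥0∞) ^ 2 ^ s₀ := by
    have := (continuous_bilSup T s₀ s₁).measurable
    fun_prop
  rw [lintegral_mask_mask hmeas hind hIJ hf, ← lintegral_const_mul _ (by fun_prop)]
  refine lintegral_mono fun ω => ?_
  rw [← mul_pow]
  exact lintegral_bilSup_pow_le hL hξ hind hN hT hG I _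

end Chaos

/-! ### Chaining for families of operators with bounded columns -/

section Chain

variable {ι : Type*} {H : Type*} [NormedAddCommGroup H] [InnerProductSpace ℝ H]

/-- `b` is a chain through the sets `F s`, `s₀ ≤ s ≤ s₁`. -/
def IsPath {M : Type*} (F : ℕ → Finset M) (s₀ s₁ : ℕ) (b : ℕ → M) : Prop :=
  ∀ s ∈ Finset.Icc s₀ s₁, b s ∈ F s

open scoped Classical in
/-- The pairs `(D, E)` entering the chaining at level `s`: `D` is an increment between the levels
`s` and `s + 1`, or a point of level `s` (the increment of a chain that starts at `0`), and `E` is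
a point of one of the two levels. -/
def chainPairs (F : ℕ → Finset (EuclideanSpace ℝ ι →L[ℝ] H)) (s : ℕ) :
    Finset ((EuclideanSpace ℝ ι →L[ℝ] H) × (EuclideanSpace ℝ ι →L[ℝ] H)) :=
  (Finset.image₂ (fun B C => B - C) (F (s + 1)) (F s) ∪ F s) ×ˢ (F (s + 1) ∪ F s)

lemma card_chainPairs_le {F : ℕ → Finset (EuclideanSpace ℝ ι →L[ℝ] H)} {s : ℕ}
    (h0 : (F s).card ≤ 2 ^ 2 ^ s) (h1 : (F (s + 1)).card ≤ 2 ^ 2 ^ (s + 1)) :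
    (chainPairs F s).card ≤ 128 ^ 2 ^ s := by
  classical
  set u := 2 ^ 2 ^ s with hu
  have hu2 : 2 ≤ u := le_self_pow₀ (by norm_num) (by positivity)
  have h1' : (F (s + 1)).card ≤ u ^ 2 := by rwa [pow_succ 2 s, pow_mul] at h1
  have hD : (Finset.image₂ (fun B C => B - C) (F (s + 1)) (F s) ∪ F s).card ≤ u ^ 2 * u + u :=
    (Finset.card_union_le _ _).trans
      (add_le_add ((Finset.card_image₂_le _ _ _).trans (Nat.mul_le_mul h1' h0)) h0)
  have hE : (F (s + 1) ∪ F s).card ≤ u ^ 2 + u :=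
    (Finset.card_union_le _ _).trans (add_le_add h1' h0)
  have hc : (128 : ℕ) ^ 2 ^ s = u ^ 7 := by
    rw [hu, ← pow_mul, mul_comm, pow_mul]; norm_num
  rw [hc, chainPairs, Finset.card_product]
  calc _ ≤ (u ^ 2 * u + u) * (u ^ 2 + u) := Nat.mul_le_mul (by convert hD) (by convert hE)
    _ ≤ (2 * u ^ 3) * (2 * u ^ 2) := by
        gcongr
        · nlinarith [Nat.mul_le_mul hu2 hu2]
        · nlinarith
    _ = 4 * u ^ 5 := by ring
    _ ≤ u ^ 2 * u ^ 5 := by gcongr; nlinarith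
    _ = u ^ 7 := by ring

variable [Fintype ι]

/-- The length `∑ 2 ^ (s / 2) ‖b (s + 1) - b s‖` of a chain. -/
def pathLength (s₀ s₁ : ℕ) (b : ℕ → EuclideanSpace ℝ ι →L[ℝ] H) : ℝ :=
  ∑ s ∈ Finset.Ico s₀ s₁, √(2 ^ s) * ‖b (s + 1) - b s‖

lemma pathLength_nonneg (s₀ s₁ : ℕ) (b : ℕ → EuclideanSpace ℝ ι →L[ℝ] H) :
    0 ≤ pathLength s₀ s₁ b := Finset.sum_nonneg fun s _ => by positivity

lemma abs_sub_le_pathLength_mul {F : ℕ → Finset (EuclideanSpace ℝ ι →L[ℝ] H)} {s₀ s₁ : ℕ}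
    (h01 : s₀ ≤ s₁) {b : ℕ → EuclideanSpace ℝ ι →L[ℝ] H} (hb : IsPath F s₀ s₁ b)
    {φ : (EuclideanSpace ℝ ι →L[ℝ] H) → ℝ} {M : ℝ}
    (hφ : ∀ s ∈ Finset.Icc s₀ s₁, ∀ B ∈ F (s + 1), ∀ C ∈ F s,
      |φ B - φ C| ≤ √(2 ^ s) * ‖B - C‖ * M) :
    |φ (b s₁) - φ (b s₀)| ≤ pathLength s₀ s₁ b * M := by
  have htel : φ (b s₁) - φ (b s₀) = ∑ s ∈ Finset.Ico s₀ s₁, (φ (b (s + 1)) - φ (b s)) := by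
    rw [Finset.sum_Ico_sub (fun s => φ (b s)) h01]
  rw [htel, pathLength, Finset.sum_mul]
  refine (Finset.abs_sum_le_sum_abs _ _).trans (Finset.sum_le_sum fun s hs => ?_)
  have hs' := Finset.mem_Ico.1 hs
  exact hφ s (Finset.mem_Icc.2 ⟨hs'.1, hs'.2.le⟩) _ (hb _ (Finset.mem_Icc.2 (by lia))) _
    (hb _ (Finset.mem_Icc.2 (by lia)))

/-- The chaining bound for the decoupled process, made symmetric in its two arguments. -/
def chaos (F : ℕ → Finset (EuclideanSpace ℝ ι →L[ℝ] H)) (s₀ s₁ : ℕ) (x y : EuclideanSpace ℝ ι) :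
    ℝ := bilSup (chainPairs F) s₀ s₁ x y + bilSup (chainPairs F) s₀ s₁ y x

lemma chaos_nonneg (F : ℕ → Finset (EuclideanSpace ℝ ι →L[ℝ] H)) (s₀ s₁ : ℕ)
    (x y : EuclideanSpace ℝ ι) : 0 ≤ chaos F s₀ s₁ x y := by unfold chaos; positivity

lemma abs_inner_sub_inner_le {F : ℕ → Finset (EuclideanSpace ℝ ι →L[ℝ] H)} {s₀ s₁ s : ℕ}
    (hs : s ∈ Finset.Icc s₀ s₁) {B C : EuclideanSpace ℝ ι →L[ℝ] H} (hB : B ∈ F (s + 1))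
    (hC : C ∈ F s) (x y : EuclideanSpace ℝ ι) :
    |inner ℝ (B x) (B y) - inner ℝ (C x) (C y)| ≤ √(2 ^ s) * ‖B - C‖ * chaos F s₀ s₁ x y := by
  classical
  have h1 : (B - C, B) ∈ chainPairs F s := by
    simp only [chainPairs, Finset.mem_product, Finset.mem_union]
    exact ⟨Or.inl (Finset.mem_image₂_of_mem hB hC), Or.inl hB⟩
  have h2 : (B - C, C) ∈ chainPairs F s := by
    simp only [chainPairs, Finset.mem_product, Finset.mem_union]
    exact ⟨Or.inl (Finset.mem_image₂_of_mem hB hC), Or.inr hC⟩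
  have h3 := abs_inner_le_bilSup hs h1 x y
  have h4 := abs_inner_le_bilSup hs h2 y x
  have h5 : inner ℝ (B x) (B y) - inner ℝ (C x) (C y) =
      inner ℝ ((B - C) x) (B y) + inner ℝ ((B - C) y) (C x) := by
    simp only [sub_apply, inner_sub_left]
    rw [real_inner_comm (C x) (B y), real_inner_comm (C x) (C y)]
    ring
  rw [h5, chaos, mul_add]
  exact (abs_add_le _ _).trans (add_le_add h3 h4)

/-- The first step, from `0` to `B`, of a chain that starts at `0`. -/
lemma abs_inner_self_le_chaos {F : ℕ → Finset (EuclideanSpace ℝ ι →L[ℝ] H)} {s₀ s₁ : ℕ}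
    (h01 : s₀ ≤ s₁) {B : EuclideanSpace ℝ ι →L[ℝ] H} (hB : B ∈ F s₀) (x y : EuclideanSpace ℝ ι) :
    |inner ℝ (B x) (B y)| ≤ √(2 ^ s₀) * ‖B‖ * chaos F s₀ s₁ x y := by
  classical
  have h1 : (B, B) ∈ chainPairs F s₀ := by
    simp only [chainPairs, Finset.mem_product, Finset.mem_union]
    exact ⟨Or.inr hB, Or.inr hB⟩
  refine (abs_inner_le_bilSup (Finset.left_mem_Icc.2 h01) h1 x y).trans ?_
  gcongr
  rw [chaos]
  exact le_add_of_nonneg_right (NNReal.coe_nonneg _)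

/-- The hypotheses on a finite family `G` of operators and on its admissible sequence `F`: the
columns have norm at most `β`, all Hilbert–Schmidt norms equal `√n`, and the operator norms are at
most `ρ`. -/
structure IsChainFamily (G : Finset (EuclideanSpace ℝ ι →L[ℝ] H))
    (F : ℕ → Finset (EuclideanSpace ℝ ι →L[ℝ] H)) (s₀ : ℕ) (β ρ : ℝ) : Prop where
  subset : ∀ s, s₀ ≤ s → F s ⊆ G
  card_le : ∀ s, s₀ ≤ s → (F s).card ≤ 2 ^ 2 ^ s
  col_le : ∀ A ∈ G, ∀ i, ‖A (EuclideanSpace.basisFun ι ℝ i)‖ ≤ β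
  sum_col : ∀ A ∈ G, ∑ i, ‖A (EuclideanSpace.basisFun ι ℝ i)‖ ^ 2 = Fintype.card ι
  norm_le : ∀ A ∈ G, ‖A‖ ≤ ρ

open scoped Classical in
/-- The average of the decoupled chaining bounds over all splittings of the block `J`. -/
def avgChaos (F : ℕ → Finset (EuclideanSpace ℝ ι →L[ℝ] H)) (s₀ s₁ : ℕ) (J : Finset ι)
    (x : ι → ℝ) : ℝ :=
  (2 ^ J.card : ℝ)⁻¹ * ∑ I ∈ J.powerset, 4 * chaos F s₀ s₁ (mask I x) (mask (J \ I) x)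

lemma map_mask_basisFun (A : EuclideanSpace ℝ ι →L[ℝ] H) (I : Finset ι) (x : ι → ℝ) :
    A (mask I x) = ∑ i ∈ I, x i • A (EuclideanSpace.basisFun ι ℝ i) := by
  classical
  rw [map_mask]
  simp

lemma norm_map_mask_sq [DecidableEq ι] (A : EuclideanSpace ℝ ι →L[ℝ] H) (J : Finset ι)
    (x : ι → ℝ) :
    ‖A (mask J x)‖ ^ 2 = ∑ i ∈ J, ‖A (EuclideanSpace.basisFun ι ℝ i)‖ ^ 2 * x i ^ 2 +
      (2 ^ J.card : ℝ)⁻¹ * ∑ I ∈ J.powerset,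
        4 * inner ℝ (A (mask I x)) (A (mask (J \ I) x)) := by
  simp_rw [map_mask_basisFun]
  rw [norm_sum_sq_eq_sum_add_average]
  congr 1
  refine Finset.sum_congr rfl fun i _ => ?_
  rw [norm_smul, mul_pow, Real.norm_eq_abs, sq_abs, mul_comm]

/-- Averaging a bound for the decoupled forms bounds the off-diagonal parts. -/
lemma abs_average_le [DecidableEq ι] {F : ℕ → Finset (EuclideanSpace ℝ ι →L[ℝ] H)} {s₀ s₁ : ℕ}
    {J : Finset ι} {x : ι → ℝ} {f : Finset ι → ℝ} {c : ℝ}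
    (hf : ∀ I ∈ J.powerset, |f I| ≤ c * chaos F s₀ s₁ (mask I x) (mask (J \ I) x)) :
    |(2 ^ J.card : ℝ)⁻¹ * ∑ I ∈ J.powerset, 4 * f I| ≤ c * avgChaos F s₀ s₁ J x := by
  rw [abs_mul, abs_of_pos (by positivity : (0 : ℝ) < (2 ^ J.card : ℝ)⁻¹), avgChaos, mul_left_comm]
  gcongr
  refine (Finset.abs_sum_le_sum_abs _ _).trans ?_
  rw [Finset.mul_sum]
  refine Finset.sum_le_sum fun I hI => ?_
  rw [abs_mul, abs_of_pos (by norm_num : (0 : ℝ) < 4)]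
  have := hf I hI
  calc 4 * |f I| ≤ 4 * (c * chaos F s₀ s₁ (mask I x) (mask (J \ I) x)) := by linarith
    _ = _ := by ring_nf; congr!

lemma supNorm_mask_sq_le {G : Finset (EuclideanSpace ℝ ι →L[ℝ] H)} (hG : G.Nonempty)
    {F : ℕ → Finset (EuclideanSpace ℝ ι →L[ℝ] H)} {s₀ s₁ : ℕ} {β ρ γ : ℝ}
    (hF : IsChainFamily G F s₀ β ρ) (h01 : s₀ ≤ s₁)
    (hpath : ∀ A ∈ G, ∃ b, IsPath F s₀ s₁ b ∧ b s₁ = A ∧ pathLength s₀ s₁ b ≤ γ)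
    (J : Finset ι) (x : ι → ℝ) :
    (supNorm G (mask J x) : ℝ) ^ 2 ≤ β ^ 2 * ∑ i, x i ^ 2 +
      (γ + √(2 ^ s₀) * ρ) * avgChaos F s₀ s₁ J x := by
  classical
  obtain ⟨A₀, hA₀⟩ := hG
  have key : ∀ A ∈ G, ‖A (mask J x)‖ ^ 2 ≤ β ^ 2 * ∑ i, x i ^ 2 +
      (γ + √(2 ^ s₀) * ρ) * avgChaos F s₀ s₁ J x := by
    intro A hA
    obtain ⟨b, hb, hbA, hlen⟩ := hpath A hA
    rw [norm_map_mask_sq]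
    refine add_le_add ?_ ((le_abs_self _).trans (abs_average_le fun I _ => ?_))
    · rw [Finset.mul_sum]
      refine (Finset.sum_le_sum fun i _ => ?_).trans
        (Finset.sum_le_sum_of_subset_of_nonneg (Finset.subset_univ J) fun i _ _ => by positivity)
      gcongr
      exact hF.col_le A hA i
    · set y := mask I x
      set z := mask (J \ I) x
      have h1 := abs_sub_le_pathLength_mul h01 hb (φ := fun A => inner ℝ (A y) (A z))
        (M := chaos F s₀ s₁ y z) fun s hs B hB C hC => abs_inner_sub_inner_le hs hB hC y z
      have hb0 : b s₀ ∈ F s₀ := hb _ (Finset.left_mem_Icc.2 h01)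
      have h2 := abs_inner_self_le_chaos h01 hb0 y z
      have h3 : ‖b s₀‖ ≤ ρ := hF.norm_le _ (hF.subset s₀ le_rfl hb0)
      have h4 := chaos_nonneg F s₀ s₁ y z
      simp only [hbA] at h1
      calc |inner ℝ (A y) (A z)|
          ≤ |inner ℝ (A y) (A z) - inner ℝ (b s₀ y) (b s₀ z)| + |inner ℝ (b s₀ y) (b s₀ z)| := by
            simpa using abs_add_le (inner ℝ (A y) (A z) - inner ℝ (b s₀ y) (b s₀ z))
              (inner ℝ (b s₀ y) (b s₀ z))
        _ ≤ pathLength s₀ s₁ b * chaos F s₀ s₁ y z + √(2 ^ s₀) * ‖b s₀‖ * chaos F s₀ s₁ y z :=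
            add_le_add h1 h2
        _ ≤ γ * chaos F s₀ s₁ y z + √(2 ^ s₀) * ρ * chaos F s₀ s₁ y z := by gcongr
        _ = _ := by ring
  have hB0 := (sq_nonneg _).trans (key A₀ hA₀)
  have := sup_pow_le_of_forall (T := G) (f := fun A => ‖A (mask J x)‖₊) (p := 2) two_ne_zero
    (B := ⟨_, hB0⟩) fun A hA => NNReal.coe_le_coe.1 (by push_cast; exact key A hA)
  rw [← NNReal.coe_pow]
  exact NNReal.coe_le_coe.2 this

/-! ### The diagonal part -/

open scoped Classical in
/-- The pairs of neighbouring levels `s` with `2 ^ s ≤ n`, for which Bernstein's inequality is in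
its subgaussian range. -/
def diagPairs (F : ℕ → Finset (EuclideanSpace ℝ ι →L[ℝ] H)) (s : ℕ) :
    Finset ((EuclideanSpace ℝ ι →L[ℝ] H) × (EuclideanSpace ℝ ι →L[ℝ] H)) :=
  if 2 ^ s ≤ Fintype.card ι then F (s + 1) ×ˢ F s else ∅

/-- The coefficients `‖B eᵢ‖² - ‖C eᵢ‖²`. -/
def diagCoeff (B C : EuclideanSpace ℝ ι →L[ℝ] H) (i : ι) : ℝ :=
  ‖B (EuclideanSpace.basisFun ι ℝ i)‖ ^ 2 - ‖C (EuclideanSpace.basisFun ι ℝ i)‖ ^ 2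

/-- The normalized supremum of the diagonal increments. -/
def diagSup (F : ℕ → Finset (EuclideanSpace ℝ ι →L[ℝ] H)) (s₀ s₁ : ℕ) (x : ι → ℝ) : ℝ≥0 :=
  (Finset.Icc s₀ s₁).sup fun s => (diagPairs F s).sup fun τ =>
    ‖∑ i, diagCoeff τ.1 τ.2 i * (x i ^ 2 - 1)‖₊ / (NNReal.sqrt (2 ^ s) * ‖τ.1 - τ.2‖₊)

lemma abs_diagCoeff_le {β : ℝ} {B C : EuclideanSpace ℝ ι →L[ℝ] H}
    (hB : ∀ i, ‖B (EuclideanSpace.basisFun ι ℝ i)‖ ≤ β)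
    (hC : ∀ i, ‖C (EuclideanSpace.basisFun ι ℝ i)‖ ≤ β) (i : ι) :
    |diagCoeff B C i| ≤ 2 * β * ‖B - C‖ := by
  have h1 : |‖B (EuclideanSpace.basisFun ι ℝ i)‖ - ‖C (EuclideanSpace.basisFun ι ℝ i)‖| ≤
      ‖B - C‖ := by
    refine (abs_norm_sub_norm_le _ _).trans ?_
    rw [← sub_apply]
    refine ((B - C).le_opNorm _).trans_eq ?_
    rw [(EuclideanSpace.basisFun ι ℝ).norm_eq_one, mul_one]
  have h2 := hB i
  have h3 := hC i
  have hβ : 0 ≤ β := (norm_nonneg _).trans h2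
  rw [diagCoeff, sq_sub_sq, abs_mul, abs_of_nonneg (by positivity)]
  gcongr
  linarith

lemma abs_sum_diagCoeff_le {G : Finset (EuclideanSpace ℝ ι →L[ℝ] H)}
    {F : ℕ → Finset (EuclideanSpace ℝ ι →L[ℝ] H)} {s₀ s₁ s : ℕ} {β ρ : ℝ} (hβ : 0 ≤ β)
    (hF : IsChainFamily G F s₀ β ρ) (hn : 0 < Fintype.card ι)
    (hs : s ∈ Finset.Icc s₀ s₁) {B C : EuclideanSpace ℝ ι →L[ℝ] H} (hB : B ∈ F (s + 1))
    (hC : C ∈ F s) (x : ι → ℝ) :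
    |∑ i, diagCoeff B C i * x i ^ 2| ≤ √(2 ^ s) * ‖B - C‖ *
      (diagSup F s₀ s₁ x + 2 * β / √(Fintype.card ι) * ∑ i, x i ^ 2) := by
  classical
  have hs' := (Finset.mem_Icc.1 hs).1
  have hBG := hF.subset (s + 1) (by lia) hB
  have hCG := hF.subset s hs' hC
  have hQ : 0 ≤ ∑ i, x i ^ 2 := Finset.sum_nonneg fun i _ => sq_nonneg _
  have hn' : (0 : ℝ) < Fintype.card ι := by exact_mod_cast hn
  by_cases hsn : 2 ^ s ≤ Fintype.card ι
  · rcases eq_or_ne B C with rfl | hBC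
    · simp [diagCoeff]
    have hD : 0 < ‖B - C‖ := norm_pos_iff.2 (sub_ne_zero.2 hBC)
    have hsum : ∑ i, diagCoeff B C i * x i ^ 2 = ∑ i, diagCoeff B C i * (x i ^ 2 - 1) := by
      have h0 : ∑ i, diagCoeff B C i = 0 := by
        simp only [diagCoeff]
        rw [Finset.sum_sub_distrib, hF.sum_col B hBG, hF.sum_col C hCG, sub_self]
      simp_rw [mul_sub, mul_one]
      rw [Finset.sum_sub_distrib, h0, sub_zero]
    have hmem : (B, C) ∈ diagPairs F s := by
      rw [diagPairs, if_pos hsn]; exact Finset.mk_mem_product hB hC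
    have h1 : ‖∑ i, diagCoeff B C i * (x i ^ 2 - 1)‖₊ / (NNReal.sqrt (2 ^ s) * ‖B - C‖₊) ≤
        diagSup F s₀ s₁ x :=
      (Finset.le_sup (f := fun τ : (EuclideanSpace ℝ ι →L[ℝ] H) × (EuclideanSpace ℝ ι →L[ℝ] H) =>
        ‖∑ i, diagCoeff τ.1 τ.2 i * (x i ^ 2 - 1)‖₊ / (NNReal.sqrt (2 ^ s) * ‖τ.1 - τ.2‖₊))
        hmem).trans (Finset.le_sup (f := fun s => (diagPairs F s).sup fun τ =>
        ‖∑ i, diagCoeff τ.1 τ.2 i * (x i ^ 2 - 1)‖₊ / (NNReal.sqrt (2 ^ s) * ‖τ.1 - τ.2‖₊)) hs)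
    have h2 := NNReal.coe_le_coe.2 h1
    push_cast at h2
    rw [div_le_iff₀ (by positivity), Real.norm_eq_abs] at h2
    rw [hsum]
    calc _ ≤ √(2 ^ s) * ‖B - C‖ * (diagSup F s₀ s₁ x : ℝ) := by linarith
      _ ≤ _ := by gcongr; exact le_add_of_nonneg_right (by positivity)
  · -- Beyond `n` the triangle inequality suffices, since `√n ≤ 2 ^ (s / 2)`.
    have hsn' : √(Fintype.card ι) ≤ √(2 ^ s) :=
      Real.sqrt_le_sqrt (by exact_mod_cast (not_le.1 hsn).le)
    calc |∑ i, diagCoeff B C i * x i ^ 2| ≤ ∑ i, 2 * β * ‖B - C‖ * x i ^ 2 := by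
          refine (Finset.abs_sum_le_sum_abs _ _).trans (Finset.sum_le_sum fun i _ => ?_)
          rw [abs_mul, abs_of_nonneg (sq_nonneg (x i))]
          gcongr
          exact abs_diagCoeff_le (hF.col_le B hBG) (hF.col_le C hCG) i
      _ = √(Fintype.card ι) * ‖B - C‖ * (2 * β / √(Fintype.card ι) * ∑ i, x i ^ 2) := by
          rw [← Finset.mul_sum]; field_simp
      _ ≤ √(2 ^ s) * ‖B - C‖ * (2 * β / √(Fintype.card ι) * ∑ i, x i ^ 2) := by gcongr
      _ ≤ _ := by gcongr; exact le_add_of_nonneg_left (NNReal.coe_nonneg _)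

/-- The random variable that, multiplied by the length of a chain, bounds the difference of
`‖A x‖²` between its two ends. -/
def majorant (F : ℕ → Finset (EuclideanSpace ℝ ι →L[ℝ] H)) (s₀ s₁ : ℕ) (β : ℝ) (x : ι → ℝ) : ℝ :=
  avgChaos F s₀ s₁ Finset.univ x +
    (diagSup F s₀ s₁ x + 2 * β / √(Fintype.card ι) * ∑ i, x i ^ 2)

lemma abs_norm_sq_sub_norm_sq_le {G : Finset (EuclideanSpace ℝ ι →L[ℝ] H)}
    {F : ℕ → Finset (EuclideanSpace ℝ ι →L[ℝ] H)} {s₀ s₁ : ℕ} {β ρ : ℝ} (hβ : 0 ≤ β)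
    (hF : IsChainFamily G F s₀ β ρ) (hn : 0 < Fintype.card ι) (h01 : s₀ ≤ s₁)
    {b : ℕ → EuclideanSpace ℝ ι →L[ℝ] H} (hb : IsPath F s₀ s₁ b) (x : ι → ℝ) :
    |‖b s₁ (WithLp.toLp 2 x)‖ ^ 2 - ‖b s₀ (WithLp.toLp 2 x)‖ ^ 2| ≤
      pathLength s₀ s₁ b * majorant F s₀ s₁ β x := by
  classical
  have hx : WithLp.toLp 2 x = mask Finset.univ x := by simp [mask]
  rw [hx, norm_map_mask_sq, norm_map_mask_sq, majorant]
  have hdiag := abs_sub_le_pathLength_mul h01 hb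
    (φ := fun A => ∑ i, ‖A (EuclideanSpace.basisFun ι ℝ i)‖ ^ 2 * x i ^ 2)
    (M := diagSup F s₀ s₁ x + 2 * β / √(Fintype.card ι) * ∑ i, x i ^ 2)
    fun s hs B hB C hC => by
      have := abs_sum_diagCoeff_le hβ hF hn hs hB hC x
      simp only [diagCoeff, sub_mul, Finset.sum_sub_distrib] at this
      exact this
  have hoff := abs_average_le (F := F) (s₀ := s₀) (s₁ := s₁) (J := Finset.univ) (x := x)
    (f := fun I => inner ℝ (b s₁ (mask I x)) (b s₁ (mask (Finset.univ \ I) x)) -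
      inner ℝ (b s₀ (mask I x)) (b s₀ (mask (Finset.univ \ I) x)))
    (c := pathLength s₀ s₁ b) fun I _ =>
      abs_sub_le_pathLength_mul h01 hb
        (φ := fun A => inner ℝ (A (mask I x)) (A (mask (Finset.univ \ I) x)))
        fun s hs B hB C hC => abs_inner_sub_inner_le hs hB hC _ _
  simp only [mul_sub, Finset.sum_sub_distrib] at hoff
  rw [mul_add, add_sub_add_comm, add_comm (pathLength s₀ s₁ b * _)]
  exact (abs_add_le _ _).trans (add_le_add hdiag hoff)

end Chain

/-! ### Moments of the majorant -/

section Moments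

variable {ι : Type*} {H : Type*} [NormedAddCommGroup H] [InnerProductSpace ℝ H]
  {Ω : Type*} [MeasurableSpace Ω] {μ : Measure Ω} {ξ : ι → Ω → ℝ} {L : ℝ}

lemma eLpNorm_const_mul_of_nonneg {c : ℝ} (hc : 0 ≤ c) (f : Ω → ℝ) (p : ℝ≥0∞) :
    eLpNorm (fun ω => c * f ω) p μ = ENNReal.ofReal c * eLpNorm f p μ := by
  have := eLpNorm_const_smul c f p μ
  rwa [Real.enorm_of_nonneg hc] at this

lemma eLpNorm_supNorm_sq {G : Finset (EuclideanSpace ℝ ι →L[ℝ] H)} {s₀ : ℕ} (J : Finset ι) :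
    eLpNorm (fun ω => (supNorm G (mask J fun i => ξ i ω) : ℝ) ^ 2) (2 ^ s₀ : ℕ) μ =
      eLpNorm (fun ω => (supNorm G (mask J fun i => ξ i ω) : ℝ)) (2 * 2 ^ s₀ : ℕ) μ ^ 2 := by
  have hq : 2 ^ s₀ ≠ 0 := by positivity
  refine le_antisymm ((ENNReal.pow_le_pow_left_iff hq).1 (le_of_eq ?_))
    ((ENNReal.pow_le_pow_left_iff hq).1 (le_of_eq ?_))
  all_goals
    rw [← pow_mul, eLpNorm_coe_pow_eq (f := fun ω => supNorm G (mask J fun i => ξ i ω))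
      (by positivity), eLpNorm_pow_eq_lintegral hq]
    simp [← pow_mul]

variable [Fintype ι]

lemma measurable_bilSup_mask (hξ : ∀ i, Measurable (ξ i))
    (T : ℕ → Finset ((EuclideanSpace ℝ ι →L[ℝ] H) × (EuclideanSpace ℝ ι →L[ℝ] H))) (s₀ s₁ : ℕ)
    (I J : Finset ι) :
    Measurable fun ω => bilSup T s₀ s₁ (mask I fun i => ξ i ω) (mask J fun i => ξ i ω) := by
  have hI : Measurable fun ω => mask I fun i => ξ i ω :=
    (measurable_mask I).comp (measurable_pi_lambda _ hξ)
  have hJ : Measurable fun ω => mask J fun i => ξ i ω :=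
    (measurable_mask J).comp (measurable_pi_lambda _ hξ)
  have h := (continuous_bilSup T s₀ s₁).measurable.comp (hI.prodMk hJ)
  simpa only [Function.comp_def] using h

lemma measurable_supNorm_mask (hξ : ∀ i, Measurable (ξ i))
    (G : Finset (EuclideanSpace ℝ ι →L[ℝ] H)) (J : Finset ι) :
    Measurable fun ω => supNorm G (mask J fun i => ξ i ω) :=
  (continuous_supNorm G).measurable.comp
    ((measurable_mask J).comp (measurable_pi_lambda _ hξ))

lemma measurable_chaos_mask (hξ : ∀ i, Measurable (ξ i))
    (F : ℕ → Finset (EuclideanSpace ℝ ι →L[ℝ] H)) (s₀ s₁ : ℕ) (I J : Finset ι) :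
    Measurable fun ω => chaos F s₀ s₁ (mask I fun i => ξ i ω) (mask J fun i => ξ i ω) := by
  have h1 := measurable_bilSup_mask hξ (chainPairs F) s₀ s₁ I J
  have h2 := measurable_bilSup_mask hξ (chainPairs F) s₀ s₁ J I
  unfold chaos
  fun_prop

lemma measurable_avgChaos (hξ : ∀ i, Measurable (ξ i))
    (F : ℕ → Finset (EuclideanSpace ℝ ι →L[ℝ] H)) (s₀ s₁ : ℕ) (J : Finset ι) :
    Measurable fun ω => avgChaos F s₀ s₁ J fun i => ξ i ω := by
  classical
  refine Measurable.const_mul (Finset.measurable_sum _ fun I _ => ?_) _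
  exact (measurable_chaos_mask hξ F s₀ s₁ I _).const_mul 4

lemma measurable_diagSup (hξ : ∀ i, Measurable (ξ i))
    (F : ℕ → Finset (EuclideanSpace ℝ ι →L[ℝ] H)) (s₀ s₁ : ℕ) :
    Measurable fun ω => diagSup F s₀ s₁ fun i => ξ i ω := by
  have h : Continuous (diagSup F s₀ s₁ : (ι → ℝ) → ℝ≥0) :=
    Continuous.finset_sup_apply fun s _ => Continuous.finset_sup_apply fun τ _ =>
      Continuous.div_const (by fun_prop) _
  exact h.measurable.comp (measurable_pi_lambda _ hξ)

lemma measurable_majorant (hξ : ∀ i, Measurable (ξ i))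
    (F : ℕ → Finset (EuclideanSpace ℝ ι →L[ℝ] H)) (s₀ s₁ : ℕ) (β : ℝ) :
    Measurable fun ω => majorant F s₀ s₁ β fun i => ξ i ω := by
  have h1 := measurable_avgChaos hξ F s₀ s₁ Finset.univ
  have h2 := measurable_diagSup hξ F s₀ s₁
  unfold majorant
  fun_prop

variable [IsProbabilityMeasure μ]

/-- The constant relating the decoupled process to `supNorm`. -/
def chaosConst (L : ℝ) : ℝ := 8 * (4 * (128 : ℕ) * linConst L)

lemma chaosConst_pos (L : ℝ) : 0 < chaosConst L := by
  have := linConst_pos L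
  unfold chaosConst; positivity

variable {G : Finset (EuclideanSpace ℝ ι →L[ℝ] H)} {F : ℕ → Finset (EuclideanSpace ℝ ι →L[ℝ] H)}
  {s₀ s₁ : ℕ} {β ρ γ κ : ℝ}

lemma eLpNorm_avgChaos_le (hL : 0 < L) (hξ : ∀ i, IsStandardSubgaussian L (ξ i) μ)
    (hind : iIndepFun ξ μ) (hF : IsChainFamily G F s₀ β ρ) {X : ℝ≥0∞}
    (hX : ∀ J : Finset ι,
      eLpNorm (fun ω => (supNorm G (mask J fun i => ξ i ω) : ℝ)) (2 ^ s₀ : ℕ) μ ≤ X)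
    (J : Finset ι) :
    eLpNorm (fun ω => avgChaos F s₀ s₁ J fun i => ξ i ω) (2 ^ s₀ : ℕ) μ ≤
      ENNReal.ofReal (chaosConst L) * X := by
  classical
  have hmeas := fun i => (hξ i).measurable
  have hp : (1 : ℝ≥0∞) ≤ (2 ^ s₀ : ℕ) := by exact_mod_cast Nat.one_le_two_pow
  have hC := linConst_pos L
  set K : ℝ := 4 * (128 : ℕ) * linConst L with hK
  have hK0 : 0 ≤ K := by positivity
  have hbil : ∀ {I I' : Finset ι}, Disjoint I I' →
      eLpNorm (fun ω => (bilSup (chainPairs F) s₀ s₁ (mask I fun i => ξ i ω)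
        (mask I' fun i => ξ i ω) : ℝ)) (2 ^ s₀ : ℕ) μ ≤ ENNReal.ofReal K * X := by
    intro I I' hII
    refine (eLpNorm_bilSup_le hL hξ hind (N := 128) (G := G) (by norm_num) (fun s hs => ?_)
      (fun s hs τ hτ => ?_) hII).trans (by gcongr; exact hX I')
    · have hs' := (Finset.mem_Icc.1 hs).1
      exact card_chainPairs_le (hF.card_le s hs') (hF.card_le (s + 1) (by lia))
    · have hs' := (Finset.mem_Icc.1 hs).1
      simp only [chainPairs, Finset.mem_product, Finset.mem_union] at hτ
      exact hτ.2.elim (fun h => hF.subset (s + 1) (by lia) h) (fun h => hF.subset s hs' h)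
  have hchaos : ∀ I ∈ J.powerset, eLpNorm (fun ω => 4 * chaos F s₀ s₁ (mask I fun i => ξ i ω)
      (mask (J \ I) fun i => ξ i ω)) (2 ^ s₀ : ℕ) μ ≤ ENNReal.ofReal (8 * K) * X := by
    intro I _
    rw [eLpNorm_const_mul_of_nonneg (by norm_num)]
    have hd : Disjoint I (J \ I) := Finset.disjoint_sdiff
    have h1 := measurable_bilSup_mask hmeas (chainPairs F) s₀ s₁ I (J \ I)
    have h2 := measurable_bilSup_mask hmeas (chainPairs F) s₀ s₁ (J \ I) I
    have h3 := eLpNorm_add_le (μ := μ)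
      (f := fun ω => (bilSup (chainPairs F) s₀ s₁ (mask I fun i => ξ i ω)
        (mask (J \ I) fun i => ξ i ω) : ℝ))
      (g := fun ω => (bilSup (chainPairs F) s₀ s₁ (mask (J \ I) fun i => ξ i ω)
        (mask I fun i => ξ i ω) : ℝ)) (Measurable.aestronglyMeasurable (by fun_prop))
      (Measurable.aestronglyMeasurable (by fun_prop)) hp
    calc _ ≤ ENNReal.ofReal 4 * (ENNReal.ofReal K * X + ENNReal.ofReal K * X) := by
          gcongr
          exact h3.trans (add_le_add (hbil hd) (hbil hd.symm))
      _ = _ := by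
          rw [ENNReal.ofReal_mul (p := 8) (by norm_num), ENNReal.ofReal_ofNat,
            ENNReal.ofReal_ofNat]
          ring
  have hpow : (0 : ℝ) < 2 ^ J.card := by positivity
  have hexp : (fun ω => avgChaos F s₀ s₁ J fun i => ξ i ω) = fun ω => (2 ^ J.card : ℝ)⁻¹ *
      (∑ I ∈ J.powerset, fun ω => 4 * chaos F s₀ s₁ (mask I fun i => ξ i ω)
        (mask (J \ I) fun i => ξ i ω)) ω := by
    ext ω
    simp only [avgChaos, Finset.sum_apply]
  rw [hexp, eLpNorm_const_mul_of_nonneg (by positivity)]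
  calc _ ≤ ENNReal.ofReal (2 ^ J.card : ℝ)⁻¹ *
        ∑ I ∈ J.powerset, ENNReal.ofReal (8 * K) * X := by
        gcongr
        refine (eLpNorm_sum_le (fun I _ => ?_) hp).trans (Finset.sum_le_sum hchaos)
        exact ((measurable_chaos_mask hmeas F s₀ s₁ I _).const_mul 4).aestronglyMeasurable
    _ = _ := by
        rw [Finset.sum_const, Finset.card_powerset, nsmul_eq_mul, ← mul_assoc,
          ENNReal.ofReal_inv_of_pos hpow, ENNReal.ofReal_pow (by norm_num), ENNReal.ofReal_ofNat]
        push_cast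
        rw [ENNReal.inv_mul_cancel (by simp) (by simp), one_mul, chaosConst]

lemma le_sqrt_add_of_sq_le {x a b : ℝ} (ha : 0 ≤ a) (hb : 0 ≤ b)
    (h : x ^ 2 ≤ a + b * x) : x ≤ √a + b := by
  by_contra! hlt
  have h1 := Real.sq_sqrt ha
  have h2 := Real.sqrt_nonneg a
  nlinarith

/-- The bound for the moments of `sup ‖A ξ_J‖`. -/
def supBound (L κ β : ℝ) (n : ℕ) (t : ℝ) : ℝ :=
  √(β ^ 2 * (2 * normConst L κ * n)) + t * chaosConst L

/-- Finiteness of the moments, from the crude bound `‖A ξ_J‖ ≤ ρ ‖ξ‖`. -/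
lemma eLpNorm_supNorm_sq_ne_top (hL : 0 < L) (hξ : ∀ i, IsStandardSubgaussian L (ξ i) μ)
    (hind : iIndepFun ξ μ) (hF : IsChainFamily G F s₀ β ρ) (hρ : 0 ≤ ρ)
    (hκ : (2 ^ s₀ : ℝ) ≤ κ * Fintype.card ι) (J : Finset ι) :
    eLpNorm (fun ω => (supNorm G (mask J fun i => ξ i ω) : ℝ) ^ 2) (2 ^ s₀ : ℕ) μ ≠ ∞ := by
  have hsq := eLpNorm_sum_sq_le hL hξ hind (κ := κ) (q := 2 ^ s₀) Nat.one_le_two_pow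
    (by exact_mod_cast hκ)
  have hle : eLpNorm (fun ω => (supNorm G (mask J fun i => ξ i ω) : ℝ) ^ 2) (2 ^ s₀ : ℕ) μ ≤
      ENNReal.ofReal (ρ ^ 2) * eLpNorm (fun ω => ∑ i, ξ i ω ^ 2) (2 ^ s₀ : ℕ) μ := by
    rw [← eLpNorm_const_mul_of_nonneg (sq_nonneg ρ)]
    refine eLpNorm_mono_real fun ω => ?_
    rw [Real.norm_of_nonneg (by positivity)]
    have h2 : supNorm G (mask J fun i => ξ i ω) ≤
        Real.toNNReal (ρ * ‖mask J fun i => ξ i ω‖) :=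
      Finset.sup_le fun A hA => by
        refine NNReal.coe_le_coe.1 ?_
        rw [Real.coe_toNNReal _ (by positivity)]
        exact (A.le_opNorm _).trans (by gcongr; exact hF.norm_le A hA)
    have h3 := NNReal.coe_le_coe.2 h2
    rw [Real.coe_toNNReal _ (by positivity)] at h3
    calc (supNorm G (mask J fun i => ξ i ω) : ℝ) ^ 2 ≤ (ρ * ‖mask J fun i => ξ i ω‖) ^ 2 := by
          gcongr
      _ ≤ _ := by rw [mul_pow]; gcongr; exact norm_mask_sq_le _ _
  exact ne_top_of_le_ne_top
    (ENNReal.mul_ne_top ENNReal.ofReal_ne_top (ne_top_of_le_ne_top ENNReal.ofReal_ne_top hsq)) hle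

/-- One step of the self-bounding argument: decoupling and chaining bound the moments of
`sup ‖A ξ_J‖²` in terms of the moments `X` of the suprema themselves. -/
lemma eLpNorm_supNorm_sq_le (hL : 0 < L) (hξ : ∀ i, IsStandardSubgaussian L (ξ i) μ)
    (hind : iIndepFun ξ μ) (hG : G.Nonempty) (hF : IsChainFamily G F s₀ β ρ) (h01 : s₀ ≤ s₁)
    (hγ : 0 ≤ γ) (hρ : 0 ≤ ρ) (hκ : (2 ^ s₀ : ℝ) ≤ κ * Fintype.card ι)
    (hpath : ∀ A ∈ G, ∃ b, IsPath F s₀ s₁ b ∧ b s₁ = A ∧ pathLength s₀ s₁ b ≤ γ) {X : ℝ≥0∞}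
    (hX : ∀ J : Finset ι,
      eLpNorm (fun ω => (supNorm G (mask J fun i => ξ i ω) : ℝ)) (2 ^ s₀ : ℕ) μ ≤ X)
    (J : Finset ι) :
    eLpNorm (fun ω => (supNorm G (mask J fun i => ξ i ω) : ℝ) ^ 2) (2 ^ s₀ : ℕ) μ ≤
      ENNReal.ofReal (β ^ 2 * (2 * normConst L κ * Fintype.card ι)) +
        ENNReal.ofReal ((γ + √(2 ^ s₀) * ρ) * chaosConst L) * X := by
  have hmeas := fun i => (hξ i).measurable
  have hp : (1 : ℝ≥0∞) ≤ (2 ^ s₀ : ℕ) := by exact_mod_cast Nat.one_le_two_pow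
  have hsq := eLpNorm_sum_sq_le hL hξ hind (κ := κ) (q := 2 ^ s₀) Nat.one_le_two_pow
    (by exact_mod_cast hκ)
  have havg := eLpNorm_avgChaos_le (s₁ := s₁) hL hξ hind hF hX J
  have hm := measurable_avgChaos hmeas F s₀ s₁ J
  have ht : 0 ≤ γ + √(2 ^ s₀) * ρ := by positivity
  have h1 : eLpNorm (fun ω => (supNorm G (mask J fun i => ξ i ω) : ℝ) ^ 2) (2 ^ s₀ : ℕ) μ ≤
      eLpNorm ((fun ω => β ^ 2 * ∑ i, ξ i ω ^ 2) +
        fun ω => (γ + √(2 ^ s₀) * ρ) * avgChaos F s₀ s₁ J fun i => ξ i ω) (2 ^ s₀ : ℕ) μ := by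
    refine eLpNorm_mono_real fun ω => ?_
    rw [Real.norm_of_nonneg (by positivity), Pi.add_apply]
    exact supNorm_mask_sq_le hG hF h01 hpath J _
  refine h1.trans ((eLpNorm_add_le (Measurable.aestronglyMeasurable (by fun_prop))
    (Measurable.aestronglyMeasurable (by fun_prop)) hp).trans ?_)
  rw [eLpNorm_const_mul_of_nonneg (sq_nonneg β), eLpNorm_const_mul_of_nonneg ht,
    ENNReal.ofReal_mul (sq_nonneg β), ENNReal.ofReal_mul ht, mul_assoc (ENNReal.ofReal _)]
  exact add_le_add (mul_le_mul_right hsq _) (mul_le_mul_right havg _)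

/-- The moments of `sup ‖A ξ_J‖`. Decoupling bounds the square of the largest one, over all blocks
`J`, by `a + b X`, where `X` is that largest moment itself; hence `X ≤ √a + b`. -/
lemma eLpNorm_supNorm_le (hL : 0 < L) (hξ : ∀ i, IsStandardSubgaussian L (ξ i) μ)
    (hind : iIndepFun ξ μ) (hG : G.Nonempty) (hF : IsChainFamily G F s₀ β ρ) (h01 : s₀ ≤ s₁)
    (hγ : 0 ≤ γ) (hρ : 0 ≤ ρ) (hκ : (2 ^ s₀ : ℝ) ≤ κ * Fintype.card ι)
    (hpath : ∀ A ∈ G, ∃ b, IsPath F s₀ s₁ b ∧ b s₁ = A ∧ pathLength s₀ s₁ b ≤ γ)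
    (J : Finset ι) :
    eLpNorm (fun ω => (supNorm G (mask J fun i => ξ i ω) : ℝ)) (2 ^ s₀ : ℕ) μ ≤
      ENNReal.ofReal (supBound L κ β (Fintype.card ι) (γ + √(2 ^ s₀) * ρ)) := by
  have hmeas := fun i => (hξ i).measurable
  have hK := chaosConst_pos L
  have hN := normConst_pos hL κ
  obtain ⟨X, hX⟩ : ∃ X : Finset ι → ℝ≥0∞, ∀ J, X J =
    eLpNorm (fun ω => (supNorm G (mask J fun i => ξ i ω) : ℝ)) (2 * 2 ^ s₀ : ℕ) μ :=
    ⟨_, fun _ => rfl⟩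
  have hmono : ∀ J : Finset ι,
      eLpNorm (fun ω => (supNorm G (mask J fun i => ξ i ω) : ℝ)) (2 ^ s₀ : ℕ) μ ≤ X J := fun J => by
    have := measurable_supNorm_mask hmeas G J
    rw [hX]
    exact eLpNorm_le_eLpNorm_of_exponent_le (by norm_cast; lia)
      (Measurable.aestronglyMeasurable (by fun_prop))
  -- The moments are finite, which the self-bounding argument needs.
  have hfin : ∀ J, X J ≠ ∞ := by
    intro J htop
    have h1 := eLpNorm_supNorm_sq_ne_top hL hξ hind hF hρ hκ J
    rw [eLpNorm_supNorm_sq, ← hX, htop, ENNReal.top_pow two_ne_zero] at h1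
    exact h1 rfl
  obtain ⟨J₀, -, hJ₀⟩ := Finset.exists_max_image Finset.univ X ⟨∅, Finset.mem_univ _⟩
  have hself := eLpNorm_supNorm_sq_le hL hξ hind hG hF h01 hγ hρ hκ hpath (X := X J₀)
    (fun J => (hmono J).trans (hJ₀ J (Finset.mem_univ _))) J₀
  rw [eLpNorm_supNorm_sq, ← hX] at hself
  have hreal : (X J₀).toReal ^ 2 ≤ β ^ 2 * (2 * normConst L κ * Fintype.card ι) +
      (γ + √(2 ^ s₀) * ρ) * chaosConst L * (X J₀).toReal := by
    rw [← ENNReal.toReal_pow]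
    refine ENNReal.toReal_le_of_le_ofReal (by positivity) (hself.trans_eq ?_)
    rw [ENNReal.ofReal_add (by positivity) (by positivity),
      ENNReal.ofReal_mul (q := (X J₀).toReal) (by positivity), ENNReal.ofReal_toReal (hfin J₀)]
  have hfinal := le_sqrt_add_of_sq_le (by positivity) (by positivity) hreal
  refine (hmono J).trans ((hJ₀ J (Finset.mem_univ _)).trans ?_)
  rw [← ENNReal.ofReal_toReal (hfin J₀)]
  exact ENNReal.ofReal_le_ofReal hfinal

lemma eLpNorm_diagSup_le (hL : 0 < L) (hξ : ∀ i, IsStandardSubgaussian L (ξ i) μ)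
    (hind : iIndepFun ξ μ) (hβ : 0 < β) (hF : IsChainFamily G F s₀ β ρ) :
    eLpNorm (fun ω => (diagSup F s₀ s₁ fun i => ξ i ω : ℝ)) (2 ^ s₀ : ℕ) μ ≤
      ENNReal.ofReal (64 * β * sqConst L * √(Fintype.card ι)) := by
  classical
  have hmeas := fun i => (hξ i).measurable
  have hC := sqConst_pos hL
  set n := Fintype.card ι with hn
  set c : ℝ≥0 := Real.toNNReal (2 * β * (sqConst L * √n)) with hc
  have hsup := lintegral_sup_pow_le (μ := μ) (diagPairs F) s₀ s₁ (N := 8) (by norm_num)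
    (fun s hs => ?_)
    (Z := fun s τ ω => ‖∑ i, diagCoeff τ.1 τ.2 i * (ξ i ω ^ 2 - 1)‖₊ /
      (NNReal.sqrt (2 ^ s) * ‖τ.1 - τ.2‖₊)) (fun s τ => by fun_prop) (c := c)
    fun s hs τ hτ => ?_
  · rw [← ENNReal.pow_le_pow_left_iff (n := 2 ^ s₀) (by positivity),
      eLpNorm_coe_pow_eq (by positivity)]
    refine hsup.trans ?_
    have h2 : (2 : ℝ≥0∞) ≤ 2 ^ 2 ^ s₀ := le_self_pow₀ one_le_two (by positivity)
    calc _ ≤ (2 : ℝ≥0∞) ^ 2 ^ s₀ * (2 * (8 : ℕ) * c) ^ 2 ^ s₀ := by gcongr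
      _ = _ := by
        rw [← mul_pow]
        congr 1
        have h3 : 64 * β * sqConst L * √n = 32 * (2 * β * (sqConst L * √n)) := by ring
        rw [h3, ENNReal.ofReal_mul (by norm_num), ENNReal.ofReal_ofNat, hc, ENNReal.ofReal]
        push_cast
        ring
  · have hs' := (Finset.mem_Icc.1 hs).1
    rw [diagPairs]
    split_ifs
    · rw [Finset.card_product]
      refine (Nat.mul_le_mul (hF.card_le (s + 1) (by lia)) (hF.card_le s hs')).trans_eq ?_
      rw [← pow_add, pow_succ 2 s, show 2 ^ s * 2 + 2 ^ s = 3 * 2 ^ s by ring, pow_mul]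
      norm_num
    · simp
  · have hs' := (Finset.mem_Icc.1 hs).1
    rw [diagPairs] at hτ
    split_ifs at hτ with hsn
    swap
    · simp at hτ
    have hB := hF.subset (s + 1) (by lia) (Finset.mem_product.1 hτ).1
    have hC' := hF.subset s hs' (Finset.mem_product.1 hτ).2
    rcases eq_or_ne (τ.1 - τ.2) 0 with hD | hD
    · simp [hD]
    have hD0 : 0 < ‖τ.1 - τ.2‖ := norm_pos_iff.2 hD
    set m := 2 * β * ‖τ.1 - τ.2‖ with hm
    have hm0 : 0 < m := by positivity
    have hb : ∀ i, |diagCoeff τ.1 τ.2 i / m| ≤ 1 := fun i => by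
      rw [abs_div, abs_of_pos hm0, div_le_one hm0]
      exact abs_diagCoeff_le (hF.col_le _ hB) (hF.col_le _ hC') i
    have hlin := lintegral_sum_sq_sub_one_pow_le hL hξ hind hb (q := 2 ^ s) Nat.one_le_two_pow hsn
    set W : ℝ := √(2 ^ s) * ‖τ.1 - τ.2‖ with hW
    have hW0 : 0 < W := by positivity
    have h1 : ∀ ω, ((‖∑ i, diagCoeff τ.1 τ.2 i * (ξ i ω ^ 2 - 1)‖₊ /
        (NNReal.sqrt (2 ^ s) * ‖τ.1 - τ.2‖₊) : ℝ≥0) : ℝ≥0∞) ^ 2 ^ s =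
        ENNReal.ofReal (m / W) ^ 2 ^ s *
          ‖∑ i, diagCoeff τ.1 τ.2 i / m * (ξ i ω ^ 2 - 1)‖ₑ ^ 2 ^ s := fun ω => by
      rw [← mul_pow, Real.enorm_eq_ofReal_abs, ← ENNReal.ofReal_mul (by positivity),
        ENNReal.ofReal]
      congr 2
      ext
      rw [Real.coe_toNNReal _ (by positivity)]
      push_cast
      have : ∑ i, diagCoeff τ.1 τ.2 i / m * (ξ i ω ^ 2 - 1) =
          (∑ i, diagCoeff τ.1 τ.2 i * (ξ i ω ^ 2 - 1)) / m := by
        rw [Finset.sum_div]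
        exact Finset.sum_congr rfl fun i _ => by ring
      rw [this, abs_div, abs_of_pos hm0, Real.norm_eq_abs, hW]
      field_simp
    simp_rw [h1]
    rw [lintegral_const_mul _ (by fun_prop)]
    refine (mul_le_mul_right hlin _).trans_eq ?_
    rw [← mul_pow, ← ENNReal.ofReal_mul (by positivity), hc, ENNReal.ofReal]
    congr 3
    rw [hW, hm]
    push_cast
    field_simp
    rw [hn]

/-- The bound for the moments of the majorant. -/
def majorantBound (L κ β : ℝ) (n : ℕ) (t : ℝ) : ℝ :=
  chaosConst L * supBound L κ β n t + (64 * β * sqConst L * √n + 4 * β * normConst L κ * √n)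

lemma eLpNorm_majorant_le (hL : 0 < L) (hξ : ∀ i, IsStandardSubgaussian L (ξ i) μ)
    (hind : iIndepFun ξ μ) (hG : G.Nonempty) (hβ : 0 < β) (hF : IsChainFamily G F s₀ β ρ)
    (h01 : s₀ ≤ s₁) (hγ : 0 ≤ γ) (hρ : 0 ≤ ρ) (hn : 0 < Fintype.card ι)
    (hκ : (2 ^ s₀ : ℝ) ≤ κ * Fintype.card ι)
    (hpath : ∀ A ∈ G, ∃ b, IsPath F s₀ s₁ b ∧ b s₁ = A ∧ pathLength s₀ s₁ b ≤ γ) :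
    eLpNorm (fun ω => majorant F s₀ s₁ β fun i => ξ i ω) (2 ^ s₀ : ℕ) μ ≤
      ENNReal.ofReal (majorantBound L κ β (Fintype.card ι) (γ + √(2 ^ s₀) * ρ)) := by
  have hmeas := fun i => (hξ i).measurable
  have hp : (1 : ℝ≥0∞) ≤ (2 ^ s₀ : ℕ) := by exact_mod_cast Nat.one_le_two_pow
  have hK := chaosConst_pos L
  have hN := normConst_pos hL κ
  have hC := sqConst_pos hL
  have h1 := eLpNorm_avgChaos_le (s₁ := s₁) hL hξ hind hF
    (eLpNorm_supNorm_le hL hξ hind hG hF h01 hγ hρ hκ hpath) Finset.univ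
  have h2 := eLpNorm_diagSup_le (s₁ := s₁) hL hξ hind hβ hF
  have h3 := eLpNorm_sum_sq_le hL hξ hind (κ := κ) (q := 2 ^ s₀) Nat.one_le_two_pow
    (by exact_mod_cast hκ)
  have hm1 := measurable_avgChaos hmeas F s₀ s₁ Finset.univ
  have hm2 := measurable_diagSup hmeas F s₀ s₁
  set n := Fintype.card ι
  have hn' : (0 : ℝ) < n := by exact_mod_cast hn
  have hsb : 0 ≤ supBound L κ β n (γ + √(2 ^ s₀) * ρ) := by unfold supBound; positivity
  refine (eLpNorm_add_le (f := fun ω => avgChaos F s₀ s₁ Finset.univ fun i => ξ i ω)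
    (g := fun ω => (diagSup F s₀ s₁ fun i => ξ i ω : ℝ) + 2 * β / √n * ∑ i, ξ i ω ^ 2)
    (Measurable.aestronglyMeasurable (by fun_prop))
    (Measurable.aestronglyMeasurable (by fun_prop)) hp).trans ?_
  rw [majorantBound, ENNReal.ofReal_add (by positivity) (by positivity), ENNReal.ofReal_mul hK.le]
  refine add_le_add h1 ?_
  refine (eLpNorm_add_le (f := fun ω => (diagSup F s₀ s₁ fun i => ξ i ω : ℝ))
    (g := fun ω => 2 * β / √n * ∑ i, ξ i ω ^ 2)
    (Measurable.aestronglyMeasurable (by fun_prop))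
    (Measurable.aestronglyMeasurable (by fun_prop)) hp).trans ?_
  rw [ENNReal.ofReal_add (by positivity) (by positivity),
    eLpNorm_const_mul_of_nonneg (by positivity)]
  refine add_le_add h2 ((mul_le_mul_right h3 _).trans_eq ?_)
  rw [← ENNReal.ofReal_mul (by positivity)]
  congr 1
  have := Real.sq_sqrt hn'.le
  field_simp
  rw [this]
  ring

end Moments

/-! ### The matrices `Γ_x` as real operators -/

section Matrices

open Matrix

variable {𝕜 : Type*} [RCLike 𝕜] {n : ℕ}

lemma mulVec_ofReal_add (A : Matrix (Fin n) (Fin n) 𝕜) (x y : Fin n → ℝ) :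
    A.mulVec (fun j => ((x j + y j : ℝ) : 𝕜)) =
      A.mulVec (fun j => (x j : 𝕜)) + A.mulVec (fun j => (y j : 𝕜)) := by
  rw [← Matrix.mulVec_add]
  congr 1
  ext j
  simp

lemma mulVec_ofReal_mul (A : Matrix (Fin n) (Fin n) 𝕜) (c : ℝ) (x : Fin n → ℝ) :
    A.mulVec (fun j => ((c * x j : ℝ) : 𝕜)) = (c : 𝕜) • A.mulVec (fun j => (x j : 𝕜)) := by
  rw [← Matrix.mulVec_smul]
  congr 1
  ext j
  simp

/-- The action of a real or complex matrix on real vectors, as an operator between real Euclidean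
spaces: the real and imaginary parts of the image are listed separately. -/
def realify (A : Matrix (Fin n) (Fin n) 𝕜) :
    EuclideanSpace ℝ (Fin n) →L[ℝ] EuclideanSpace ℝ (Fin n ⊕ Fin n) :=
  LinearMap.toContinuousLinearMap
    { toFun := fun x => WithLp.toLp 2 (Sum.elim
        (fun i => RCLike.re (A.mulVec (fun j => (x j : 𝕜)) i))
        (fun i => RCLike.im (A.mulVec (fun j => (x j : 𝕜)) i)))
      map_add' := fun x y => by
        have h := mulVec_ofReal_add A x y
        ext i
        rcases i with i | i
        · exact (congrArg RCLike.re (congrFun h i)).trans (map_add _ _ _)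
        · exact (congrArg RCLike.im (congrFun h i)).trans (map_add _ _ _)
      map_smul' := fun c x => by
        have h := mulVec_ofReal_mul A c x
        ext i
        rcases i with i | i
        · exact (congrArg RCLike.re (congrFun h i)).trans (RCLike.re_ofReal_mul _ _)
        · exact (congrArg RCLike.im (congrFun h i)).trans (RCLike.im_ofReal_mul _ _) }

lemma realify_apply (A : Matrix (Fin n) (Fin n) 𝕜) (x : EuclideanSpace ℝ (Fin n)) :
    realify A x = WithLp.toLp 2 (Sum.elim
      (fun i => RCLike.re (A.mulVec (fun j => (x j : 𝕜)) i))
      (fun i => RCLike.im (A.mulVec (fun j => (x j : 𝕜)) i))) := rfl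

lemma actNorm_sq (A : Matrix (Fin n) (Fin n) 𝕜) (x : Fin n → ℝ) :
    actNorm A x ^ 2 = ∑ i, ‖A.mulVec (fun j => (x j : 𝕜)) i‖ ^ 2 := by
  rw [actNorm, EuclideanSpace.norm_sq_eq]

lemma norm_realify_apply (A : Matrix (Fin n) (Fin n) 𝕜) (x : EuclideanSpace ℝ (Fin n)) :
    ‖realify A x‖ = actNorm A x := by
  refine (sq_eq_sq₀ (norm_nonneg _) (norm_nonneg _)).1 ?_
  rw [← actNorm, actNorm_sq, realify_apply, EuclideanSpace.norm_sq_eq, Fintype.sum_sum_type,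
    ← Finset.sum_add_distrib]
  refine Finset.sum_congr rfl fun i _ => ?_
  simp only [Sum.elim_inl, Sum.elim_inr, Real.norm_eq_abs, sq_abs]
  rw [RCLike.norm_sq_eq_def, pow_two, pow_two]

lemma realify_sub (A B : Matrix (Fin n) (Fin n) 𝕜) : realify (A - B) = realify A - realify B := by
  ext x i
  rcases i with i | i <;> simp [realify_apply, Matrix.sub_mulVec]

lemma norm_realify_le (A : Matrix (Fin n) (Fin n) 𝕜) : ‖realify A‖ ≤ opNorm A := by
  refine ContinuousLinearMap.opNorm_le_bound _ (norm_nonneg _) fun x => ?_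
  rw [norm_realify_apply, actNorm, opNorm]
  set z : EuclideanSpace 𝕜 (Fin n) := WithLp.toLp 2 fun j => ((x j : ℝ) : 𝕜) with hz
  have h1 := (Matrix.toEuclideanCLM (n := Fin n) (𝕜 := 𝕜) A).le_opNorm z
  have h2 : ‖z‖ = ‖x‖ := by
    rw [EuclideanSpace.norm_eq, EuclideanSpace.norm_eq]
    simp [hz]
  rw [h2] at h1
  exact h1

lemma sum_norm_sq_mulVec_of_mem_unitaryGroup {U : Matrix (Fin n) (Fin n) 𝕜}
    (hU : U ∈ Matrix.unitaryGroup (Fin n) 𝕜) (z : Fin n → 𝕜) :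
    ∑ i, ‖U.mulVec z i‖ ^ 2 = ∑ i, ‖z i‖ ^ 2 := by
  have key : ∀ w : Fin n → 𝕜, ((∑ i, ‖w i‖ ^ 2 : ℝ) : 𝕜) = star w ⬝ᵥ w := fun w => by
    simp [dotProduct, RCLike.conj_mul]
  have h : star (U.mulVec z) ⬝ᵥ U.mulVec z = star z ⬝ᵥ z := by
    rw [Matrix.star_mulVec, ← Matrix.dotProduct_mulVec, Matrix.mulVec_mulVec,
      ← Matrix.star_eq_conjTranspose, (Matrix.mem_unitaryGroup_iff').1 hU, Matrix.one_mulVec]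
  rw [← key, ← key] at h
  exact_mod_cast h

lemma sum_row_norm_sq_of_mem_unitaryGroup {O : Matrix (Fin n) (Fin n) 𝕜}
    (hO : O ∈ Matrix.unitaryGroup (Fin n) 𝕜) (k : Fin n) : ∑ i, ‖O k i‖ ^ 2 = 1 := by
  have h := congrFun (congrFun ((Matrix.mem_unitaryGroup_iff).1 hO) k) k
  rw [Matrix.mul_apply, Matrix.one_apply_eq] at h
  have h2 : ((∑ i, ‖O k i‖ ^ 2 : ℝ) : 𝕜) = 1 := by
    rw [← h]
    simp [Matrix.star_apply, RCLike.mul_conj]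
  exact_mod_cast h2

variable {β : ℝ} {U W O : Matrix (Fin n) (Fin n) 𝕜}

lemma actNorm_Gam_sq (hU : IsHadamardType β U) (v : EuclideanSpace ℝ (Fin n)) (y : Fin n → ℝ) :
    actNorm (Gam U W O v) y ^ 2 = n * ∑ k, ‖W.mulVec (fun j => (v j : 𝕜)) k‖ ^ 2 *
      ‖O.mulVec (fun j => (y j : 𝕜)) k‖ ^ 2 := by
  have h : ∀ i, ‖(Gam U W O v).mulVec (fun j => (y j : 𝕜)) i‖ ^ 2 =
      n * ‖U.mulVec (fun k => W.mulVec (fun j => (v j : 𝕜)) k *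
        O.mulVec (fun j => (y j : 𝕜)) k) i‖ ^ 2 := by
    intro i
    have h2 : (Matrix.diagonal (W.mulVec fun j => (v j : 𝕜))).mulVec
        (O.mulVec fun j => (y j : 𝕜)) = fun k => W.mulVec (fun j => (v j : 𝕜)) k *
        O.mulVec (fun j => (y j : 𝕜)) k := by
      ext k; rw [Matrix.mulVec_diagonal]
    rw [Gam, Matrix.smul_mulVec, ← Matrix.mulVec_mulVec, ← Matrix.mulVec_mulVec, h2]
    rw [Pi.smul_apply, norm_smul, mul_pow, RCLike.norm_ofReal, sq_abs,
      Real.sq_sqrt (Nat.cast_nonneg n)]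
  rw [actNorm_sq]
  simp_rw [h]
  rw [← Finset.mul_sum, sum_norm_sq_mulVec_of_mem_unitaryGroup hU.1]
  simp_rw [norm_mul, mul_pow]

lemma sum_norm_sq_mulVec_ofReal (hW : IsHadamardType β W) (v : EuclideanSpace ℝ (Fin n)) :
    ∑ k, ‖W.mulVec (fun j => (v j : 𝕜)) k‖ ^ 2 = ‖v‖ ^ 2 := by
  rw [sum_norm_sq_mulVec_of_mem_unitaryGroup hW.1, EuclideanSpace.norm_sq_eq]
  simp

lemma mulVec_basisFun (O : Matrix (Fin n) (Fin n) 𝕜) (i k : Fin n) :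
    O.mulVec (fun j => ((EuclideanSpace.basisFun (Fin n) ℝ i j : ℝ) : 𝕜)) k = O k i := by
  have : (fun j => ((EuclideanSpace.basisFun (Fin n) ℝ i j : ℝ) : 𝕜)) = Pi.single i 1 := by
    ext j
    simp [Pi.single_apply, apply_ite]
  rw [this, Matrix.mulVec_single_one]
  rfl

/-- The columns of `Γ_v` are bounded because the entries of `O` are. -/
lemma norm_realify_Gam_basisFun_le (hn : 0 < n) (hβ : 0 ≤ β) (hU : IsHadamardType β U)
    (hW : IsHadamardType β W) (hO : IsHadamardType β O) {v : EuclideanSpace ℝ (Fin n)}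
    (hv : ‖v‖ = 1) (i : Fin n) :
    ‖realify (Gam U W O v) (EuclideanSpace.basisFun (Fin n) ℝ i)‖ ≤ β := by
  have hn' : (0 : ℝ) < n := by exact_mod_cast hn
  refine (sq_le_sq₀ (norm_nonneg _) hβ).1 ?_
  rw [norm_realify_apply, actNorm_Gam_sq hU]
  simp_rw [mulVec_basisFun]
  calc _ ≤ (n : ℝ) * ∑ k, ‖W.mulVec (fun j => (v j : 𝕜)) k‖ ^ 2 * (β / √n) ^ 2 := by
        gcongr with k
        exact hO.2 k i
    _ = β ^ 2 := by
        rw [← Finset.sum_mul, sum_norm_sq_mulVec_ofReal hW, hv, div_pow,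
          Real.sq_sqrt hn'.le]
        field_simp

lemma sum_norm_realify_Gam_basisFun_sq (hU : IsHadamardType β U)
    (hW : IsHadamardType β W) (hO : IsHadamardType β O) {v : EuclideanSpace ℝ (Fin n)}
    (hv : ‖v‖ = 1) :
    ∑ i, ‖realify (Gam U W O v) (EuclideanSpace.basisFun (Fin n) ℝ i)‖ ^ 2 = n := by
  simp_rw [norm_realify_apply, actNorm_Gam_sq hU, mulVec_basisFun]
  rw [← Finset.mul_sum, Finset.sum_comm]
  simp_rw [← Finset.mul_sum, sum_row_norm_sq_of_mem_unitaryGroup hO.1, mul_one]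
  rw [sum_norm_sq_mulVec_ofReal hW, hv]
  simp

/-- For sparse `v` the entries of `W v` are at most `β √(r / n)`, by Cauchy–Schwarz. -/
lemma norm_mulVec_sq_le_of_mem_sparseSphere (hW : IsHadamardType β W) {r : ℕ}
    {v : EuclideanSpace ℝ (Fin n)} (hv : v ∈ sparseSphere n r) (k : Fin n) :
    ‖W.mulVec (fun j => (v j : 𝕜)) k‖ ^ 2 ≤ (β / √n) ^ 2 * r := by
  classical
  set S : Finset (Fin n) := Finset.univ.filter fun j => v j ≠ 0 with hS
  have hcard : (S.card : ℝ) ≤ r := by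
    have h := hv.1
    rw [show {i | v i ≠ 0} = (S : Set (Fin n)) by ext; simp [hS], Set.ncard_coe_finset] at h
    exact_mod_cast h
  have h1 : W.mulVec (fun j => (v j : 𝕜)) k = ∑ j ∈ S, W k j * (v j : 𝕜) := by
    rw [Matrix.mulVec, dotProduct, hS, Finset.sum_filter_of_ne]
    intro j _ h hj
    simp [hj] at h
  have h2 : ‖W.mulVec (fun j => (v j : 𝕜)) k‖ ≤ ∑ j ∈ S, β / √n * |v j| := by
    rw [h1]
    refine (norm_sum_le _ _).trans (Finset.sum_le_sum fun j _ => ?_)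
    rw [norm_mul, RCLike.norm_ofReal]
    gcongr
    exact hW.2 k j
  have h3 : (∑ j ∈ S, |v j|) ^ 2 ≤ r := by
    have hv2 : ∑ j, v j ^ 2 = 1 := by
      have := EuclideanSpace.norm_sq_eq v
      rw [hv.2] at this
      simpa using this.symm
    calc (∑ j ∈ S, |v j|) ^ 2 ≤ S.card * ∑ j ∈ S, |v j| ^ 2 := sq_sum_le_card_mul_sum_sq
      _ ≤ S.card * ∑ j, v j ^ 2 := by
          gcongr
          simp_rw [sq_abs]
          exact Finset.sum_le_sum_of_subset_of_nonneg (Finset.subset_univ _)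
            fun j _ _ => sq_nonneg _
      _ ≤ r := by rw [hv2, mul_one]; exact hcard
  calc _ ≤ (∑ j ∈ S, β / √n * |v j|) ^ 2 := by gcongr
    _ = (β / √n) ^ 2 * (∑ j ∈ S, |v j|) ^ 2 := by rw [← Finset.mul_sum, mul_pow]
    _ ≤ _ := by gcongr

lemma norm_realify_Gam_le (hn : 0 < n) (hβ : 0 ≤ β) (hU : IsHadamardType β U)
    (hW : IsHadamardType β W) (hO : IsHadamardType β O) {r : ℕ} {v : EuclideanSpace ℝ (Fin n)}
    (hv : v ∈ sparseSphere n r) : ‖realify (Gam U W O v)‖ ≤ β * √r := by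
  have hn' : (0 : ℝ) < n := by exact_mod_cast hn
  refine ContinuousLinearMap.opNorm_le_bound _ (by positivity) fun y => ?_
  refine (sq_le_sq₀ (norm_nonneg _) (by positivity)).1 ?_
  rw [norm_realify_apply, actNorm_Gam_sq hU]
  calc _ ≤ (n : ℝ) * ∑ k, (β / √n) ^ 2 * r * ‖O.mulVec (fun j => (y j : 𝕜)) k‖ ^ 2 := by
        gcongr with k
        exact norm_mulVec_sq_le_of_mem_sparseSphere hW hv k
    _ = _ := by
        rw [← Finset.mul_sum, sum_norm_sq_mulVec_ofReal hO, div_pow, Real.sq_sqrt hn'.le, mul_pow,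
          mul_pow, Real.sq_sqrt (Nat.cast_nonneg r)]
        field_simp

lemma opNorm_nonneg (A : Matrix (Fin n) (Fin n) 𝕜) : 0 ≤ opNorm A := norm_nonneg _

lemma eq_of_opNorm_sub_le_zero {A B : Matrix (Fin n) (Fin n) 𝕜} (h : opNorm (A - B) ≤ 0) :
    A = B := by
  have h1 : Matrix.toEuclideanCLM (n := Fin n) (𝕜 := 𝕜) (A - B) = 0 := norm_le_zero_iff.1 h
  rw [map_sub, sub_eq_zero] at h1
  exact (Matrix.toEuclideanCLM (n := Fin n) (𝕜 := 𝕜)).injective h1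

end Matrices

/-- The constant `C` in `‖majorant‖_p ≤ C (γ + √n)`. -/
def totalConst (L β κ : ℝ) : ℝ :=
  chaosConst L * (√(β ^ 2 * (2 * normConst L κ)) + (1 + β * √κ) * chaosConst L) +
    (64 * β * sqConst L + 4 * β * normConst L κ)

lemma totalConst_pos {L β : ℝ} (hL : 0 < L) (hβ : 0 < β) (κ : ℝ) : 0 < totalConst L β κ := by
  have hK := chaosConst_pos L
  have hN := normConst_pos hL κ
  have hC := sqConst_pos hL
  unfold totalConst; positivity

lemma majorantBound_le {L β κ γ t : ℝ} (hL : 0 < L) (hβ : 0 < β) (hγ : 0 ≤ γ) (n : ℕ)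
    (ht : t ≤ γ + β * √κ * √n) :
    majorantBound L κ β n t ≤ totalConst L β κ * (γ + √n) := by
  have hK := chaosConst_pos L
  have hN := normConst_pos hL κ
  have hC := sqConst_pos hL
  have h1 : supBound L κ β n t ≤
      (√(β ^ 2 * (2 * normConst L κ)) + (1 + β * √κ) * chaosConst L) * (γ + √n) := by
    have ht' : t ≤ (1 + β * √κ) * (γ + √n) := by
      have : 0 ≤ β * √κ * γ := by positivity
      nlinarith [Real.sqrt_nonneg (n : ℝ)]
    rw [supBound, ← mul_assoc (β ^ 2), ← mul_assoc, Real.sqrt_mul (by positivity), add_mul]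
    refine add_le_add ?_ ?_
    · exact mul_le_mul_of_nonneg_left (by linarith) (Real.sqrt_nonneg _)
    · calc t * chaosConst L ≤ (1 + β * √κ) * (γ + √n) * chaosConst L := by gcongr
        _ = _ := by ring
  rw [majorantBound, totalConst, add_mul]
  refine add_le_add ?_ ?_
  · rw [mul_assoc]; gcongr
  · rw [← add_mul]
    gcongr
    linarith

/-! ### The tail bound -/

lemma two_rpow_div_two (s : ℕ) : (2 : ℝ) ^ ((s : ℝ) / 2) = √(2 ^ s) := by
  rw [Real.sqrt_eq_rpow, ← Real.rpow_natCast, ← Real.rpow_mul two_pos.le]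
  congr 1
  ring

open scoped Classical in
/-- The finite set of real operators attached to the members of `𝒜` that lie in `B`. -/
def operatorsOf {𝕜 : Type*} [RCLike 𝕜] {n : ℕ} {𝒜 : Set (Matrix (Fin n) (Fin n) 𝕜)}
    (h𝒜 : 𝒜.Finite) (B : Set (Matrix (Fin n) (Fin n) 𝕜)) :
    Finset (EuclideanSpace ℝ (Fin n) →L[ℝ] EuclideanSpace ℝ (Fin n ⊕ Fin n)) :=
  (h𝒜.toFinset.filter (· ∈ B)).image realify

lemma mem_operatorsOf {𝕜 : Type*} [RCLike 𝕜] {n : ℕ} {𝒜 : Set (Matrix (Fin n) (Fin n) 𝕜)}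
    {h𝒜 : 𝒜.Finite} {B : Set (Matrix (Fin n) (Fin n) 𝕜)}
    {T : EuclideanSpace ℝ (Fin n) →L[ℝ] EuclideanSpace ℝ (Fin n ⊕ Fin n)} :
    T ∈ operatorsOf h𝒜 B ↔ ∃ A ∈ 𝒜, A ∈ B ∧ realify A = T := by
  simp [operatorsOf, and_assoc]

lemma le_measureReal_of_eLpNorm_le {Ω : Type*} [MeasurableSpace Ω] {μ : Measure Ω}
    [IsProbabilityMeasure μ] {Y : Ω → ℝ} (hY : Measurable Y) {p : ℕ} (hp : p ≠ 0) {M : ℝ}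
    (hM : 0 < M) (h : eLpNorm Y p μ ≤ ENNReal.ofReal M) :
    1 - (2 : ℝ)⁻¹ ^ p ≤ μ.real {ω | Y ω < 2 * M} := by
  have h1 := meas_ge_le_mul_pow_eLpNorm_enorm (f := Y) μ (p := p) (by exact_mod_cast hp) (by simp)
    hY.aestronglyMeasurable (ε := ENNReal.ofReal (2 * M)) (by simpa using hM) (by simp)
  simp only [ENNReal.toReal_natCast, ENNReal.rpow_natCast] at h1
  have h2 : μ {ω | ENNReal.ofReal (2 * M) ≤ ‖Y ω‖ₑ} ≤ ENNReal.ofReal ((2 : ℝ)⁻¹ ^ p) := by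
    refine h1.trans ?_
    rw [← mul_pow, ENNReal.ofReal_pow (by norm_num)]
    gcongr
    calc _ ≤ (ENNReal.ofReal (2 * M))⁻¹ * ENNReal.ofReal M := by gcongr
      _ = _ := by
        rw [← ENNReal.ofReal_inv_of_pos (by positivity), ← ENNReal.ofReal_mul (by positivity)]
        congr 1
        field_simp
  have h3 : {ω | Y ω < 2 * M}ᶜ ⊆ {ω | ENNReal.ofReal (2 * M) ≤ ‖Y ω‖ₑ} := by
    intro ω hω
    simp only [Set.mem_compl_iff, Set.mem_ofPred_eq, not_lt] at hω ⊢
    rw [Real.enorm_eq_ofReal_abs]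
    exact ENNReal.ofReal_le_ofReal (hω.trans (le_abs_self _))
  have h4 : μ.real {ω | Y ω < 2 * M}ᶜ ≤ (2 : ℝ)⁻¹ ^ p :=
    ENNReal.toReal_le_of_le_ofReal (by positivity) ((measure_mono h3).trans h2)
  rw [probReal_compl_eq_one_sub (measurableSet_lt hY measurable_const)] at h4
  linarith

lemma abs_actNorm_sq_sub_eq {𝕜 : Type*} [RCLike 𝕜] {n : ℕ} (A B : Matrix (Fin n) (Fin n) 𝕜)
    (x : Fin n → ℝ) :
    |actNorm A x ^ 2 - actNorm B x ^ 2| =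
      |‖realify A (WithLp.toLp 2 x)‖ ^ 2 - ‖realify B (WithLp.toLp 2 x)‖ ^ 2| := by
  rw [norm_realify_apply, norm_realify_apply]

section Gamma

variable {𝕜 : Type*} [RCLike 𝕜] {n : ℕ} {𝒜 : Set (Matrix (Fin n) (Fin n) 𝕜)} {s₀ s₁ : ℕ}
  {𝒜s : ℕ → Set (Matrix (Fin n) (Fin n) 𝕜)}
  {proj : ℕ → Matrix (Fin n) (Fin n) 𝕜 → Matrix (Fin n) (Fin n) 𝕜}

lemma gammaTrunc_nonneg : 0 ≤ gammaTrunc 𝒜 s₀ s₁ proj :=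
  Real.iSup_nonneg fun _ => Finset.sum_nonneg fun _ _ =>
    mul_nonneg (by positivity) (opNorm_nonneg _)

lemma pathLength_le_gammaTrunc (h𝒜 : 𝒜.Finite) {A : Matrix (Fin n) (Fin n) 𝕜} (hA : A ∈ 𝒜) :
    pathLength s₀ s₁ (fun s => realify (proj s A)) ≤ gammaTrunc 𝒜 s₀ s₁ proj := by
  have := h𝒜.to_subtype
  refine le_trans (Finset.sum_le_sum fun s _ => ?_)
    (le_ciSup (f := fun A : 𝒜 => ∑ s ∈ Finset.Ico s₀ s₁,
      (2 : ℝ) ^ ((s : ℝ) / 2) * opNorm (proj (s + 1) A.1 - proj s A.1))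
      (Set.finite_range _).bddAbove ⟨A, hA⟩)
  rw [two_rpow_div_two, ← realify_sub]
  gcongr
  exact norm_realify_le _

lemma isPath_realify_proj (h𝒜 : 𝒜.Finite) (hadm : IsAdmissible 𝒜 s₀ 𝒜s)
    (hproj : IsNearestPoint 𝒜 s₀ 𝒜s proj) {A : Matrix (Fin n) (Fin n) 𝕜} (hA : A ∈ 𝒜) :
    IsPath (fun s => operatorsOf h𝒜 (𝒜s s)) s₀ s₁ (fun s => realify (proj s A)) := by
  intro s hs
  have hs' := (Finset.mem_Icc.1 hs).1
  have h1 := (hproj s hs' A hA).1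
  exact mem_operatorsOf.2 ⟨_, (hadm s hs').1 h1, h1, rfl⟩

lemma proj_eq_self (h01 : s₀ ≤ s₁) (hproj : IsNearestPoint 𝒜 s₀ 𝒜s proj) (htop : 𝒜s s₁ = 𝒜)
    {A : Matrix (Fin n) (Fin n) 𝕜} (hA : A ∈ 𝒜) : proj s₁ A = A := by
  have h := (hproj s₁ h01 A hA).2 A (htop ▸ hA)
  refine (eq_of_opNorm_sub_le_zero (h.trans_eq ?_)).symm
  simp [opNorm]

lemma isChainFamily_operatorsOf {β : ℝ} {r : ℕ} {U W O : Matrix (Fin n) (Fin n) 𝕜}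
    {V : Set (EuclideanSpace ℝ (Fin n))} (hn : 0 < n) (hβ : 0 ≤ β) (hU : IsHadamardType β U)
    (hW : IsHadamardType β W) (hO : IsHadamardType β O) (hV : V ⊆ sparseSphere n r)
    (h𝒜 : (Gam U W O '' V).Finite) (hadm : IsAdmissible (Gam U W O '' V) s₀ 𝒜s) :
    IsChainFamily (operatorsOf h𝒜 Set.univ) (fun s => operatorsOf h𝒜 (𝒜s s)) s₀ β (β * √r) where
  subset s _ T hT := by
    obtain ⟨A, hA, -, rfl⟩ := mem_operatorsOf.1 hT
    exact mem_operatorsOf.2 ⟨A, hA, trivial, rfl⟩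
  card_le s hs := by
    classical
    obtain ⟨-, hfin, hcard⟩ := hadm s hs
    refine Finset.card_image_le.trans (le_trans ?_ hcard)
    rw [← Set.ncard_coe_finset]
    refine Set.ncard_le_ncard (fun A hA => ?_) hfin
    simp only [Finset.coe_filter, Set.mem_ofPred_eq] at hA
    exact hA.2
  col_le T hT i := by
    obtain ⟨_, ⟨v, hv, rfl⟩, -, rfl⟩ := mem_operatorsOf.1 hT
    exact norm_realify_Gam_basisFun_le hn hβ hU hW hO (hV hv).2 i
  sum_col T hT := by
    obtain ⟨_, ⟨v, hv, rfl⟩, -, rfl⟩ := mem_operatorsOf.1 hT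
    rw [sum_norm_realify_Gam_basisFun_sq hU hW hO (hV hv).2, Fintype.card_fin]
  norm_le T hT := by
    obtain ⟨_, ⟨v, hv, rfl⟩, -, rfl⟩ := mem_operatorsOf.1 hT
    exact norm_realify_Gam_le hn hβ hU hW hO (hV hv)

end Gamma

end CirculantChaining

end

open CirculantChaining

theorem mainTheorem7 (L β κ : ℝ) (hL : 0 < L) (hβ : 1 ≤ β) (hκ : 0 < κ) :
    ∃ c₁ c₂ : ℝ, 0 < c₁ ∧ 0 < c₂ ∧
      ∀ (𝕜 : Type) [RCLike 𝕜] (Ω : Type*) [MeasurableSpace Ω] (μ : Measure Ω)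
        [IsProbabilityMeasure μ] (n r s₀ s₁ : ℕ) (ξ : Fin n → Ω → ℝ)
        (U W O : Matrix (Fin n) (Fin n) 𝕜) (V : Set (EuclideanSpace ℝ (Fin n)))
        (𝒜 : Set (Matrix (Fin n) (Fin n) 𝕜)) (𝒜s : ℕ → Set (Matrix (Fin n) (Fin n) 𝕜))
        (proj : ℕ → Matrix (Fin n) (Fin n) 𝕜 → Matrix (Fin n) (Fin n) 𝕜),
        1 ≤ r → r ≤ n →
        κ * n / r / 2 ≤ (2 : ℝ) ^ s₀ → (2 : ℝ) ^ s₀ ≤ 2 * (κ * n / r) → s₀ ≤ s₁ →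
        (∀ i, CirculantChaining.IsStandardSubgaussian L (ξ i) μ) → iIndepFun ξ μ →
        CirculantChaining.IsHadamardType β U → CirculantChaining.IsHadamardType β W →
        CirculantChaining.IsHadamardType β O →
        V ⊆ CirculantChaining.sparseSphere n r → V.Finite → V.ncard ≤ 2 ^ (2 ^ s₁) →
        𝒜 = CirculantChaining.Gam U W O '' V →
        CirculantChaining.IsAdmissible 𝒜 s₀ 𝒜s → 𝒜s s₁ = 𝒜 →
        CirculantChaining.IsNearestPoint 𝒜 s₀ 𝒜s proj →
        1 - (2 : ℝ) ^ (-(c₁ * n / r)) ≤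
          μ.real {ω |
            (⨆ A : 𝒜, |CirculantChaining.actNorm A.1 (fun i => ξ i ω) ^ 2 -
              CirculantChaining.actNorm (proj s₀ A.1) (fun i => ξ i ω) ^ 2|) ≤
            c₂ * CirculantChaining.gammaTrunc 𝒜 s₀ s₁ proj *
              (CirculantChaining.gammaTrunc 𝒜 s₀ s₁ proj + √(n : ℝ))} := by
  have hβ0 : 0 < β := one_pos.trans_le hβ
  have hC := totalConst_pos hL hβ0 (2 * κ)
  -- The moments have order `2 ^ s₀ ≤ 2 κ n`, whence the argument `2 κ` of the constant.
  refine ⟨κ / 2, 2 * totalConst L β (2 * κ), by positivity, by positivity, ?_⟩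
  intro 𝕜 _ Ω _ μ _ n r s₀ s₁ ξ U W O V 𝒜 𝒜s proj hr hrn hs₀ hs₀' h01 hξ hind hU hW hO hV hVfin _
    h𝒜def hadm htop hproj
  have hn : 0 < n := by lia
  have hn' : (0 : ℝ) < n := by exact_mod_cast hn
  have hr' : (1 : ℝ) ≤ r := by exact_mod_cast hr
  have hγ : 0 ≤ gammaTrunc 𝒜 s₀ s₁ proj := gammaTrunc_nonneg
  have hRHS : 0 ≤ 2 * totalConst L β (2 * κ) * gammaTrunc 𝒜 s₀ s₁ proj *
      (gammaTrunc 𝒜 s₀ s₁ proj + √(n : ℝ)) := by positivity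
  -- Over an empty family the supremum on the left is `0` by convention.
  rcases 𝒜.eq_empty_or_nonempty with hempty | hne
  · have hall : ∀ ω, (⨆ A : 𝒜, |actNorm A.1 (fun i => ξ i ω) ^ 2 -
        actNorm (proj s₀ A.1) (fun i => ξ i ω) ^ 2|) ≤ 2 * totalConst L β (2 * κ) *
        gammaTrunc 𝒜 s₀ s₁ proj * (gammaTrunc 𝒜 s₀ s₁ proj + √(n : ℝ)) := fun ω =>
      Real.iSup_le (fun A => absurd A.2 (by simp [hempty])) hRHS
    simp only [hall, Set.ofPred_true, probReal_univ]
    linarith [Real.rpow_pos_of_pos two_pos (-(κ / 2 * n / r))]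
  subst h𝒜def
  have h𝒜 : (Gam U W O '' V).Finite := hVfin.image _
  set 𝒜 := Gam U W O '' V with h𝒜def
  set γ := gammaTrunc 𝒜 s₀ s₁ proj with hγdef
  set F := fun s => operatorsOf h𝒜 (𝒜s s) with hFdef
  have hF : IsChainFamily (operatorsOf h𝒜 Set.univ) F s₀ β (β * √r) :=
    isChainFamily_operatorsOf hn hβ0.le hU hW hO hV h𝒜 hadm
  have hG : (operatorsOf h𝒜 Set.univ).Nonempty := by
    obtain ⟨A, hA⟩ := hne
    exact ⟨_, mem_operatorsOf.2 ⟨A, hA, trivial, rfl⟩⟩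
  have hpath : ∀ T ∈ operatorsOf h𝒜 Set.univ,
      ∃ b, IsPath F s₀ s₁ b ∧ b s₁ = T ∧ pathLength s₀ s₁ b ≤ γ := by
    intro T hT
    obtain ⟨A, hA, -, rfl⟩ := mem_operatorsOf.1 hT
    exact ⟨_, isPath_realify_proj h𝒜 hadm hproj hA,
      congrArg realify (proj_eq_self h01 hproj htop hA), pathLength_le_gammaTrunc h𝒜 hA⟩
  have hκn : (2 : ℝ) ^ s₀ ≤ 2 * κ * Fintype.card (Fin n) := by
    rw [Fintype.card_fin]
    refine hs₀'.trans ?_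
    rw [mul_assoc]
    gcongr
    exact div_le_self (by positivity) hr'
  -- `2 ^ s₀` is of order `n / r` precisely so that `2 ^ (s₀ / 2) ‖Γ_v‖` is of order `√n`.
  have hbase : γ + √(2 ^ s₀) * (β * √r) ≤ γ + β * √(2 * κ) * √n := by
    have h1 : √(2 ^ s₀) * √r ≤ √(2 * κ) * √n := by
      rw [← Real.sqrt_mul (by positivity), ← Real.sqrt_mul (by positivity)]
      refine Real.sqrt_le_sqrt ?_
      calc (2 : ℝ) ^ s₀ * r ≤ 2 * (κ * n / r) * r := by gcongr
        _ = 2 * κ * n := by field_simp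
    nlinarith
  have hmaj := eLpNorm_majorant_le hL hξ hind hG hβ0 hF h01 hγ (by positivity)
    (by simpa using hn) hκn hpath
  rw [Fintype.card_fin] at hmaj
  have htail := le_measureReal_of_eLpNorm_le
    (measurable_majorant (fun i => (hξ i).measurable) F s₀ s₁ β) (p := 2 ^ s₀) (by positivity)
    (M := totalConst L β (2 * κ) * (γ + √n)) (by positivity)
    (hmaj.trans (ENNReal.ofReal_le_ofReal (majorantBound_le hL hβ0 hγ n hbase)))
  have hprob : (2 : ℝ)⁻¹ ^ 2 ^ s₀ ≤ (2 : ℝ) ^ (-(κ / 2 * n / r)) := by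
    rw [inv_pow, ← Real.rpow_natCast, ← Real.rpow_neg two_pos.le]
    refine Real.rpow_le_rpow_of_exponent_le one_le_two (neg_le_neg ?_)
    push_cast
    refine le_trans (le_of_eq ?_) hs₀
    ring
  refine (sub_le_sub_left hprob 1).trans (htail.trans (measureReal_mono fun ω hω => ?_))
  simp only [Set.mem_ofPred_eq] at hω ⊢
  refine Real.iSup_le (fun A => ?_) hRHS
  have hb := abs_norm_sq_sub_norm_sq_le hβ0.le hF (by simpa using hn) h01
    (isPath_realify_proj (s₁ := s₁) h𝒜 hadm hproj A.2) (fun i => ξ i ω)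
  rw [abs_actNorm_sq_sub_eq]
  simp only [proj_eq_self h01 hproj htop A.2] at hb
  refine hb.trans ?_
  have hlen := pathLength_le_gammaTrunc (s₀ := s₀) (s₁ := s₁) (proj := proj) h𝒜 A.2
  calc _ ≤ pathLength s₀ s₁ (fun s => realify (proj s A.1)) *
        (2 * (totalConst L β (2 * κ) * (γ + √n))) := by
        gcongr
        exact pathLength_nonneg _ _ _
    _ ≤ γ * (2 * (totalConst L β (2 * κ) * (γ + √n))) := by gcongr
    _ = _ := by ring
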